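/- Let $\mathbb H=\{a+bk: a,b\in\mathbb R\}$, $k^2=1$, be the hyperbolic numbers, $e_\pm=(1\pm k)/2$, and write $p=\lambda_1e_++\lambda_2e_-$ with $\lambda_1=a+b$, $\lambda_2=a-b$ for $p=a+bk$. Put $|p|_{\mathbb H}^{2H}=|\lambda_1|^{2H}e_++|\lambda_2|^{2H}e_-$. *Noise.* Let $\sigma,\mu$ be positive Borel measures on $\mathbb R$ with $\int\frac{d\sigma(u)}{u^2+1}<\infty$ and $\int\frac{d\mu(u)}{u^2+1}<\infty$. On the space $\mathcal S'_{\mathbb R}$ of real tempered distributions with its cylinder $\sigma$-algebra, let $P_1$ be the (Bochner–Minlos) probability measure with $\int e^{i\langle s,\omega\rangle}dP_1(\omega)=\exp\big(-\tfrac12\int|\widehat s(u)|^2d\sigma(u)\big)$ for all $s\in\mathcal S_{\mathbb R}$, where $\widehat s(u)=\int e^{-iut}s(t)\,dt$, and let $P_2$ be the analogous measure for $\mu$. Let $\mathcal H(\sigma)$ be the closure of $\{\widehat s: s\in\mathcal S_{\mathbb R}\}$ in $L^2(\sigma)$, with the real inner product $\mathrm{Re}\int\overline{f}g\,d\sigma$,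 and let $Q:\mathcal H(\sigma)\to L^2(P_1)$ be the continuous extension of $\widehat s\mapsto\langle s,\cdot\rangle$. Let $g_0,g_1,\dots$ be an orthonormal sequence in $\mathcal H(\sigma)$ and $Z_n=Q_{g_n}$. Similarly let $W_n=Q_{h_n}\in L^2(P_2)$ for an orthonormal sequence $h_0,h_1,\dots$ in $\mathcal H(\mu)$. Write $P_{\mathbb H}=P_1e_++P_2e_-$, and for $X=X_1e_++X_2e_-$ set $E_{\mathbb H}X=\big(\int X_1dP_1\big)e_++\big(\int X_2dP_2\big)e_-$. An $\mathbb H$-valued process $X=X_1e_++X_2e_-$ indexed by $\mathbb H$ is Gaussian if $X_1$ is a Gaussian process under $P_1$ and $X_2$ is a Gaussian process under $P_2$; its covariance function is $E_{\mathbb H}(X(p)X(q))$. *Process.* Let $H\in(0,1)$, $m(u)=\frac{|u|^{1-2H}}{2\pi}$, and let $$\zeta_n(z)=\frac{(-1)^n}{\pi^{1/4}2^{n/2}(n!)^{1/2}}e^{z^2/2}\frac{d^n}{dz^n}e^{-z^2},\qquad n\ge0,$$ be the normalized Hermite functions. For $t\in\mathbb R$ set $$c_n(t)=\int_{\mathbb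 R}\frac{1-\cos tu}{u}\zeta_n(u)\sqrt{m(u)}\,du,\qquad s_n(t)=\int_{\mathbb R}\frac{\sin tu}{u}\zeta_n(u)\sqrt{m(u)}\,du,$$ $$B^{(1)}_t=\sum_{n\ge0} c_n(t)Z_{2n},\quad B^{(2)}_t=\sum_{n\ge0} c_n(t)W_{2n},\quad B^{(3)}_t=\sum_{n\ge0} s_n(t)Z_{2n+1},\quad B^{(4)}_t=\sum_{n\ge0} s_n(t)W_{2n+1},$$ the first and third series being taken in $L^2(P_1)$ and the other two in $L^2(P_2)$. **Theorem.** The integrals $c_n(t),s_n(t)$ converge absolutely, the four series converge, and (for any choice of versions of the sums) the $\mathbb H$-valued process $$B^H_p=\big(B^{(1)}_{\lambda_1}+B^{(3)}_{\lambda_1}\big)e_++\big(B^{(2)}_{\lambda_2}+B^{(4)}_{\lambda_2}\big)e_-,\qquad p=\lambda_1e_++\lambda_2e_-\in\mathbb H,$$ has components in $L^2(P_1)$ and $L^2(P_2)$ respectively, and is centered ($E_{\mathbb H}B^H_p=0$) and Gaussian, with covariance function $$E_{\mathbb H}(B^H_pB^H_q)=\frac{V_H}{\pi}\left(|p|_{\mathbb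 H}^{2H}+|q|_{\mathbb H}^{2H}-|p-q|_{\mathbb H}^{2H}\right),\qquad p,q\in\mathbb H,$$ where $V_H=\int_0^\infty\frac{1-\cos u}{u^2}u^{1-2H}du$ is a convergent integral, equal to $\frac{\Gamma(2-2H)\cos(H\pi)}{(1-2H)\,2H}$ if $H\neq\frac12$ and to $\frac{\pi}{2}$ if $H=\frac12$. -/

import Mathlib

noncomputable section

namespace HypFBM

open MeasureTheory ProbabilityTheory Filter Topology
open scoped SchwartzMap ENNReal

/-! ## Hyperbolic numbers -/

/-- The hyperbolic numbers `a + b k`, `k ^ 2 = 1`, as the real quadratic algebra with `k² = 1 + 0 k`.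
The field `re` is `a` and the field `im` is `b`. -/
abbrev Hyperbolic : Type := QuadraticAlgebra ℝ 1 0

/-- `e₊ = (1 + k) / 2`. -/
def ePlus : Hyperbolic := ⟨1 / 2, 1 / 2⟩

/-- `e₋ = (1 - k) / 2`. -/
def eMinus : Hyperbolic := ⟨1 / 2, -(1 / 2)⟩

/-- First idempotent coordinate `λ₁ = a + b` of `p = a + b k`. -/
def lam₁ (p : Hyperbolic) : ℝ := p.re + p.im

/-- Second idempotent coordinate `λ₂ = a - b` of `p = a + b k`. -/
def lam₂ (p : Hyperbolic) : ℝ := p.re - p.im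

/-- The hyperbolic number `U diag(x, y) U = x e₊ + y e₋`. -/
def diagH (x y : ℝ) : Hyperbolic := x • ePlus + y • eMinus

/-- The matrix representation `a + b k ↦ [a, b; b, a]`. -/
def toMatrix (p : Hyperbolic) : Matrix (Fin 2) (Fin 2) ℝ := !![p.re, p.im; p.im, p.re]

/-- The matrix `U = 2^{-1/2} [1, 1; 1, -1]`. -/
def matU : Matrix (Fin 2) (Fin 2) ℝ := (1 / √2 : ℝ) • !![1, 1; 1, -1]

theorem toMatrix_diagH (x y : ℝ) : toMatrix (diagH x y) = matU * !![x, 0; 0, y] * matU := by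
  have h : (√2)⁻¹ * (√2)⁻¹ = (1 / 2 : ℝ) := by
    rw [← mul_inv, Real.mul_self_sqrt (by norm_num)]; norm_num
  ext i j
  fin_cases i <;> fin_cases j <;>
    simp [toMatrix, diagH, matU, ePlus, eMinus, Matrix.mul_apply, Fin.sum_univ_two]
  · linear_combination (-(x + y)) * h
  · linear_combination (-(x - y)) * h
  · linear_combination (-(x - y)) * h
  · linear_combination (-(x + y)) * h

theorem diagH_lam (p : Hyperbolic) : diagH (lam₁ p) (lam₂ p) = p := by
  ext <;> simp [diagH, lam₁, lam₂, ePlus, eMinus] <;> ring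

/-- The extension `f_ℍ(p) = U diag(f λ₁, f λ₂) U` of a real function `f` to `ℍ`. -/
def extendH (f : ℝ → ℝ) (p : Hyperbolic) : Hyperbolic := diagH (f (lam₁ p)) (f (lam₂ p))

/-- `|p|_ℍ`. -/
def absH (p : Hyperbolic) : Hyperbolic := extendH (fun x => |x|) p

/-- Real powers of (non-negative) hyperbolic numbers. -/
def rpowH (p : Hyperbolic) (r : ℝ) : Hyperbolic := extendH (fun x => x ^ r) p

/-! ## Hyperbolic probability: the `ℍ`-valued probability `P_ℍ = P₁ e₊ + P₂ e₋` -/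

section Probability

variable {Ω : Type*} [MeasurableSpace Ω]

/-- The `ℍ`-valued expectation with respect to `P₁ e₊ + P₂ e₋`, of `X = X₁ e₊ + X₂ e₋`:
it is `(∫ X₁ dP₁) e₊ + (∫ X₂ dP₂) e₋`. -/
def expectationH (P₁ P₂ : Measure Ω) (X : Ω → Hyperbolic) : Hyperbolic :=
  diagH (∫ ω, lam₁ (X ω) ∂P₁) (∫ ω, lam₂ (X ω) ∂P₂)

/-- `X` is a second-order `ℍ`-valued process indexed by `ℍ`: each `X p` belongs to
`L²(P₁ e₊ + P₂ e₋) = L²(P₁) e₊ ⊕ L²(P₂) e₋`. -/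
def IsSecondOrderH (P₁ P₂ : Measure Ω) (X : Hyperbolic → Ω → Hyperbolic) : Prop :=
  ∀ p, MemLp (fun ω => lam₁ (X p ω)) 2 P₁ ∧ MemLp (fun ω => lam₂ (X p ω)) 2 P₂

/-- `X = X₁ e₊ + X₂ e₋` is Gaussian: `X₁` is a Gaussian process under `P₁` and `X₂` is a Gaussian
process under `P₂` (both indexed by `ℍ`). -/
def IsGaussianH (P₁ P₂ : Measure Ω) (X : Hyperbolic → Ω → Hyperbolic) : Prop :=
  IsGaussianProcess (fun p ω => lam₁ (X p ω)) P₁ ∧ IsGaussianProcess (fun p ω => lam₂ (X p ω)) P₂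

/-- `X` is centered: its `ℍ`-valued expectation vanishes. -/
def IsCenteredH (P₁ P₂ : Measure Ω) (X : Hyperbolic → Ω → Hyperbolic) : Prop :=
  ∀ p, expectationH P₁ P₂ (X p) = 0

/-- The covariance function `E_ℍ(X(p) X(q))`, with the product of `ℍ`. -/
def covarianceH (P₁ P₂ : Measure Ω) (X : Hyperbolic → Ω → Hyperbolic) (p q : Hyperbolic) :
    Hyperbolic :=
  expectationH P₁ P₂ (fun ω => X p ω * X q ω)

/-- `X` is the sum of the series `∑_{n ≥ 0} f n`, the convergence being in `L²(P)`. -/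
structure IsL2Sum (P : Measure Ω) (f : ℕ → Ω → ℝ) (X : Ω → ℝ) : Prop where
  memLp_term : ∀ n, MemLp (f n) 2 P
  memLp_sum : MemLp X 2 P
  tendsto : Tendsto (fun N : ℕ => eLpNorm (fun ω => (∑ n ∈ Finset.range N, f n ω) - X ω) 2 P)
    atTop (𝓝 0)

end Probability

/-! ## The white noise space -/

/-- The space `𝓢'_ℝ` of real-valued tempered distributions on the line. -/
def TemperedDual : Type := 𝓢(ℝ, ℝ) →L[ℝ] ℝ

/-- The pairing `⟨s, ω⟩`, i.e. the random variable `Q_s(ω)`. -/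
def pairing (s : 𝓢(ℝ, ℝ)) (ω : TemperedDual) : ℝ :=
  (show 𝓢(ℝ, ℝ) →L[ℝ] ℝ from ω) s

/-- The cylinder sigma-algebra of `𝓢'_ℝ`: the smallest one making all pairings measurable. -/
instance TemperedDual.instMeasurableSpace : MeasurableSpace TemperedDual :=
  ⨆ s : 𝓢(ℝ, ℝ), MeasurableSpace.comap (pairing s) inferInstance

/-- The Fourier transform `ŝ(u) = ∫ e^{-iut} s(t) dt`. -/
def fourierHat (s : 𝓢(ℝ, ℝ)) (u : ℝ) : ℂ :=
  ∫ t : ℝ, Complex.exp (-(Complex.I * u * t)) * (s t : ℂ)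

/-- The condition `∫ dσ(u) / (u² + 1) < ∞` on a positive Borel measure on the line. -/
def IsAdmissible (σ : Measure ℝ) : Prop :=
  ∫⁻ u, ENNReal.ofReal (1 / (u ^ 2 + 1)) ∂σ < ∞

/-- `P` is the Bochner–Minlos measure `P_σ`: the probability measure on `𝓢'_ℝ` (for the cylinder
sigma-algebra) with characteristic functional `exp(-½ ∫ |ŝ|² dσ)`. -/
structure IsWhiteNoiseMeasure (σ : Measure ℝ) (P : Measure TemperedDual) : Prop where
  isProbabilityMeasure : IsProbabilityMeasure P
  charFunctional : ∀ s : 𝓢(ℝ, ℝ),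
    ∫ ω, Complex.exp (Complex.I * (pairing s ω : ℂ)) ∂P =
      Complex.exp (-(((∫ u, ‖fourierHat s u‖ ^ 2 ∂σ : ℝ) : ℂ) / 2))

/-- `Z = Q_g`, where `g` belongs to the closure `𝓗(σ)` of `𝓢_ℝ` (seen in `L²(σ)` through `s ↦ ŝ`)
and `Q : 𝓗(σ) → L²(P_σ)` is the extension by continuity of the isometry `s ↦ Q_s`:
for some test functions `s k` one has `ŝ_k → g` in `L²(σ)` and `Q_{s_k} → Z` in `L²(P_σ)`. -/
def IsWienerExtension (σ : Measure ℝ) (P : Measure TemperedDual) (g : ℝ → ℂ)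
    (Z : TemperedDual → ℝ) : Prop :=
  MemLp g 2 σ ∧ MemLp Z 2 P ∧ ∃ s : ℕ → 𝓢(ℝ, ℝ),
    Tendsto (fun k => eLpNorm (fun u => fourierHat (s k) u - g u) 2 σ) atTop (𝓝 0) ∧
    Tendsto (fun k => eLpNorm (fun ω => pairing (s k) ω - Z ω) 2 P) atTop (𝓝 0)

/-- `Z n = Q_{g n}` for a sequence `g 0, g 1, …` which is orthonormal in the real Hilbert space
`𝓗(σ)`. -/
structure IsWhiteNoiseSequence (σ : Measure ℝ) (P : Measure TemperedDual) (g : ℕ → ℝ → ℂ)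
    (Z : ℕ → TemperedDual → ℝ) : Prop where
  extension : ∀ n, IsWienerExtension σ P (g n) (Z n)
  orthonormal : ∀ i j, ∫ u, (starRingEnd ℂ (g i u) * g j u).re ∂σ = if i = j then 1 else 0

/-! ## The fractional process -/

/-- The normalized (physicists') Hermite functions
`ζ_n(z) = (-1)^n / (π^{1/4} 2^{n/2} (n!)^{1/2}) e^{z²/2} (d/dz)^n e^{-z²}`. -/
def hermiteFun (n : ℕ) (z : ℝ) : ℝ :=
  (-1) ^ n / (Real.pi ^ (1 / 4 : ℝ) * 2 ^ ((n : ℝ) / 2) * √(n.factorial : ℝ)) *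
    Real.exp (z ^ 2 / 2) * iteratedDeriv n (fun x : ℝ => Real.exp (-x ^ 2)) z

/-- The spectral density `m(u) = |u|^{1 - 2H} / (2π)`. -/
def specDensity (H u : ℝ) : ℝ := |u| ^ (1 - 2 * H) / (2 * Real.pi)

/-- The integrand `((1 - cos tu) / u) ζ_n(u) √m(u)`. -/
def cosIntegrand (H : ℝ) (n : ℕ) (t u : ℝ) : ℝ :=
  (1 - Real.cos (t * u)) / u * hermiteFun n u * √(specDensity H u)

/-- The integrand `(sin tu / u) ζ_n(u) √m(u)`. -/
def sinIntegrand (H : ℝ) (n : ℕ) (t u : ℝ) : ℝ :=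
  Real.sin (t * u) / u * hermiteFun n u * √(specDensity H u)

section Series

variable {Ω : Type*} [MeasurableSpace Ω]

/-- The four real processes, as `L²`-convergent series:
`B1_t = ∑ (∫ ((1 - cos tu)/u) ζ_n √m) Z_{2n}` and `B3_t = ∑ (∫ (sin tu/u) ζ_n √m) Z_{2n+1}`
in `L²(P₁)`, and similarly `B2`, `B4` with `W` in `L²(P₂)`. -/
structure AreComponents (H : ℝ) (P₁ P₂ : Measure Ω) (Z W : ℕ → Ω → ℝ)
    (B1 B2 B3 B4 : ℝ → Ω → ℝ) : Prop where
  sum1 : ∀ t, IsL2Sum P₁ (fun n ω => (∫ u, cosIntegrand H n t u) * Z (2 * n) ω) (B1 t)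
  sum2 : ∀ t, IsL2Sum P₂ (fun n ω => (∫ u, cosIntegrand H n t u) * W (2 * n) ω) (B2 t)
  sum3 : ∀ t, IsL2Sum P₁ (fun n ω => (∫ u, sinIntegrand H n t u) * Z (2 * n + 1) ω) (B3 t)
  sum4 : ∀ t, IsL2Sum P₂ (fun n ω => (∫ u, sinIntegrand H n t u) * W (2 * n + 1) ω) (B4 t)

end Series

/-- `B_p = U diag(B1_{λ₁} + B3_{λ₁}, B2_{λ₂} + B4_{λ₂}) U` for `p = λ₁ e₊ + λ₂ e₋`. -/
def hypProcess {Ω : Type*} (B1 B2 B3 B4 : ℝ → Ω → ℝ) (p : Hyperbolic) (ω : Ω) : Hyperbolic :=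
  diagH (B1 (lam₁ p) ω + B3 (lam₁ p) ω) (B2 (lam₂ p) ω + B4 (lam₂ p) ω)

/-- The integrand `((1 - cos u) / u²) u^{1-2H}` of the constant `V_H`, on `(0, ∞)`. -/
def VIntegrand (H u : ℝ) : ℝ := (1 - Real.cos u) / u ^ 2 * u ^ (1 - 2 * H)

/-- `V_H = ∫_0^∞ (1 - cos u) u^{-2} u^{1-2H} du`. -/
def VConst (H : ℝ) : ℝ := ∫ u in Set.Ioi (0 : ℝ), VIntegrand H u

/-- `K_H(p, q) = (V_H / π) (|p|_ℍ^{2H} + |q|_ℍ^{2H} - |p - q|_ℍ^{2H})`. -/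
def KH (H : ℝ) (p q : Hyperbolic) : Hyperbolic :=
  (VConst H / Real.pi) •
    (rpowH (absH p) (2 * H) + rpowH (absH q) (2 * H) - rpowH (absH (p - q)) (2 * H))

end HypFBM

end

noncomputable section

namespace HypFBM

open MeasureTheory ProbabilityTheory Filter Topology
open scoped SchwartzMap ENNReal

/-! ## The constant `V_H` -/

/-! The idempotent coordinates `lam₁`, `lam₂` are multiplicative and subtractive, so the theorem
splits into two copies of a real statement, one under each measure. In each copy the process is `∑
c_n(t) Z_{2n} + ∑ s_n(t) Z_{2n+1}`.

Gaussianity: the characteristic functional makes each pairing centered Gaussian, and this property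
survives `L²` limits, so every element of the closed space `gaussianSpace` is centered Gaussian. The
`Z_n`, and hence the sums, lie in that space.

Covariance: `s ↦ ⟨s, ·⟩` is isometric, so the `Z_n` are orthonormal. The numbers `c_n(t)`, `s_n(t)`
are the Hermite coefficients of `cosKernel` and `sinKernel`, and the Hermite functions form a
Hilbert basis (`hermiteBasis`). Parseval turns the covariance into `∫ (cosKernel_t cosKernel_s +
sinKernel_t sinKernel_s)`; even and odd indices do not interact. A trigonometric identity
(`cosKernel_mul_add_sinKernel_mul`) and scaling (`integral_varKernel`) give the stated formula, and
`V_H` is evaluated by Gamma integrals and Tonelli. -/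

theorem setLIntegral_ofReal_of_setIntegral_eq {f : ℝ → ℝ} {s : Set ℝ} (hs : MeasurableSet s)
    {c : ℝ} (hf : ∀ x ∈ s, 0 ≤ f x) (h : ∫ x in s, f x = c) (hc : 0 < c) :
    ∫⁻ x in s, ENNReal.ofReal (f x) = ENNReal.ofReal c := by
  -- A non-integrable function has Bochner integral `0`, so the nonzero value `c` forces
  -- integrability.
  have hi : Integrable f (volume.restrict s) :=
    Integrable.of_integral_ne_zero (by rw [h]; exact hc.ne')
  rw [← h, ofReal_integral_eq_lintegral_ofReal hi]
  exact (ae_restrict_iff' hs).2 (ae_of_all _ hf)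

theorem integral_one_sub_cos_mul_exp_neg {s : ℝ} (hs : 0 < s) :
    ∫ u in Set.Ioi (0 : ℝ), (1 - Real.cos u) * Real.exp (-(s * u)) = 1 / (s * (s ^ 2 + 1)) := by
  have hs2 : s ^ 2 + 1 ≠ 0 := by positivity
  -- An explicit antiderivative that vanishes at infinity; the integral is `-F 0`.
  set F : ℝ → ℝ := fun u => Real.exp (-(s * u)) * (-(1 / s) +
    (s * Real.cos u - Real.sin u) / (s ^ 2 + 1)) with hF
  have hd : ∀ u ∈ Set.Ici (0 : ℝ), HasDerivAt F ((1 - Real.cos u) * Real.exp (-(s * u))) u := by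
    intro u _
    have h1 : HasDerivAt (fun u : ℝ => Real.exp (-(s * u))) (Real.exp (-(s * u)) * (-(s * 1))) u :=
      (((hasDerivAt_id u).const_mul s).neg).exp
    have h2 : HasDerivAt (fun u : ℝ => -(1 / s) + (s * Real.cos u - Real.sin u) / (s ^ 2 + 1))
        ((s * (-Real.sin u) - Real.cos u) / (s ^ 2 + 1)) u :=
      ((((Real.hasDerivAt_cos u).const_mul s).sub (Real.hasDerivAt_sin u)).div_const _).const_add _
    convert! h1.mul h2 using 1
    field_simp
    ring
  have hlim : Tendsto F atTop (𝓝 0) := by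
    have he : Tendsto (fun u : ℝ => Real.exp (-(s * u))) atTop (𝓝 0) :=
      Real.tendsto_exp_neg_atTop_nhds_zero.comp (tendsto_id.const_mul_atTop hs)
    refine he.zero_mul_isBoundedUnder_le ?_
    refine isBoundedUnder_of ⟨1 / s + (s + 1) / (s ^ 2 + 1), fun u => ?_⟩
    simp only [Function.comp, Real.norm_eq_abs]
    refine (abs_add_le _ _).trans (add_le_add ?_ ?_)
    · rw [abs_neg, abs_of_pos (by positivity)]
    · rw [abs_div, abs_of_pos (show 0 < s ^ 2 + 1 by positivity)]
      gcongr
      refine (abs_sub _ _).trans (add_le_add ?_ (Real.abs_sin_le_one u))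
      rw [abs_mul, abs_of_pos hs]
      exact mul_le_of_le_one_right hs.le (Real.abs_cos_le_one u)
  rw [integral_Ioi_of_hasDerivAt_of_nonneg' hd
    (fun u _ => mul_nonneg (by linarith [Real.cos_le_one u]) (Real.exp_pos _).le) hlim]
  simp only [hF, mul_zero, neg_zero, Real.exp_zero, Real.cos_zero, Real.sin_zero]
  field_simp
  ring

theorem lintegral_rpow_mul_exp_neg_mul {a r : ℝ} (ha : 0 < a) (hr : 0 < r) :
    ∫⁻ t in Set.Ioi (0 : ℝ), ENNReal.ofReal (t ^ (a - 1) * Real.exp (-(r * t))) =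
      ENNReal.ofReal ((1 / r) ^ a * Real.Gamma a) :=
  setLIntegral_ofReal_of_setIntegral_eq measurableSet_Ioi
    (fun x hx => mul_nonneg (Real.rpow_nonneg (le_of_lt hx) _) (Real.exp_pos _).le)
    (Real.integral_rpow_mul_exp_neg_mul_Ioi ha hr)
    (mul_pos (Real.rpow_pos_of_pos (by positivity) _) (Real.Gamma_pos_of_pos ha))

/-- Write `1/(s²+1) = ∫ e^{-(s²+1)x} dx` and exchange the integrals: the inner one becomes a
Gaussian moment, the outer one a Gamma integral. The product `Γ(a/2) Γ(1 - a/2)` is then given by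
the reflection formula. -/
theorem lintegral_rpow_div_one_add_sq {a : ℝ} (ha0 : 0 < a) (ha2 : a < 2) :
    ∫⁻ s in Set.Ioi (0 : ℝ), ENNReal.ofReal (s ^ (a - 1) / (s ^ 2 + 1)) =
      ENNReal.ofReal (Real.pi / (2 * Real.sin (Real.pi * (a / 2)))) := by
  have key : ∀ s ∈ Set.Ioi (0 : ℝ), ENNReal.ofReal (s ^ (a - 1) / (s ^ 2 + 1)) =
      ∫⁻ x in Set.Ioi (0 : ℝ), ENNReal.ofReal (s ^ (a - 1)) *
        ENNReal.ofReal (Real.exp (-((s ^ 2 + 1) * x))) := by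
    intro s hs
    have h := lintegral_rpow_mul_exp_neg_mul one_pos (show 0 < s ^ 2 + 1 by positivity)
    simp only [sub_self, Real.rpow_zero, one_mul, Real.rpow_one, Real.Gamma_one, mul_one] at h
    rw [lintegral_const_mul _ (by fun_prop), h,
      ← ENNReal.ofReal_mul (Real.rpow_nonneg (le_of_lt hs) _), mul_one_div]
  rw [setLIntegral_congr_fun measurableSet_Ioi key, lintegral_lintegral_swap (by fun_prop)]
  have key2 : ∀ x ∈ Set.Ioi (0 : ℝ), ∫⁻ s in Set.Ioi (0 : ℝ), ENNReal.ofReal (s ^ (a - 1)) *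
        ENNReal.ofReal (Real.exp (-((s ^ 2 + 1) * x))) =
      ENNReal.ofReal (Real.Gamma (a / 2) / 2) *
        ENNReal.ofReal (x ^ ((1 - a / 2) - 1) * Real.exp (-(1 * x))) := by
    intro x hx
    have hx' : 0 < x := hx
    have h := setLIntegral_ofReal_of_setIntegral_eq measurableSet_Ioi
      (fun s hs => mul_nonneg (Real.rpow_nonneg (le_of_lt hs) _) (Real.exp_pos _).le)
      (integral_rpow_mul_exp_neg_mul_rpow (p := 2) (q := a - 1) (b := x) two_pos (by linarith) hx)
      (mul_pos (mul_pos (Real.rpow_pos_of_pos hx _) (by norm_num))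
        (Real.Gamma_pos_of_pos (by linarith)))
    have h3 : ∀ s ∈ Set.Ioi (0 : ℝ), ENNReal.ofReal (s ^ (a - 1)) *
        ENNReal.ofReal (Real.exp (-((s ^ 2 + 1) * x))) =
        ENNReal.ofReal (Real.exp (-x)) *
          ENNReal.ofReal (s ^ (a - 1) * Real.exp (-x * s ^ (2 : ℝ))) := by
      intro s hs
      rw [← ENNReal.ofReal_mul (Real.rpow_nonneg (le_of_lt hs) _),
        ← ENNReal.ofReal_mul (Real.exp_pos _).le, mul_left_comm, ← Real.exp_add]
      norm_num
      ring_nf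
    rw [setLIntegral_congr_fun measurableSet_Ioi h3, lintegral_const_mul _ (by fun_prop), h,
      ← ENNReal.ofReal_mul (Real.exp_pos _).le, ← ENNReal.ofReal_mul
        (div_nonneg (Real.Gamma_pos_of_pos (by linarith)).le two_pos.le)]
    congr 1
    rw [show -(a - 1 + 1) / 2 = (1 - a / 2) - 1 by ring, show (a - 1 + 1) / 2 = a / 2 by ring,
      one_mul]
    ring
  rw [setLIntegral_congr_fun measurableSet_Ioi key2, lintegral_const_mul _ (by fun_prop),
    lintegral_rpow_mul_exp_neg_mul (by linarith) one_pos, ← ENNReal.ofReal_mul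
        (div_nonneg (Real.Gamma_pos_of_pos (by linarith)).le two_pos.le)]
  congr 1
  rw [div_one, Real.one_rpow, one_mul, div_mul_eq_mul_div, Real.Gamma_mul_Gamma_one_sub, div_div,
    mul_comm (Real.sin _)]

theorem sin_pi_mul_pos {x : ℝ} (h0 : 0 < x) (h1 : x < 1) : 0 < Real.sin (Real.pi * x) :=
  Real.sin_pos_of_pos_of_lt_pi (by positivity)
    (by nlinarith [Real.pi_pos])

/-- Write `u^{-(1+2H)}` as `Γ(1+2H)⁻¹ ∫ s^{2H} e^{-us} ds` and apply Tonelli; the Laplace transform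
of `1 - cos` leaves `∫ s^{2H-1}/(s²+1) ds`. Working with lower integrals yields the value and the
convergence at once. -/
theorem lintegral_VIntegrand {H : ℝ} (hH0 : 0 < H) (hH1 : H < 1) :
    ∫⁻ u in Set.Ioi (0 : ℝ), ENNReal.ofReal (VIntegrand H u) =
      ENNReal.ofReal (Real.pi / (2 * Real.Gamma (1 + 2 * H) * Real.sin (Real.pi * H))) := by
  have hG : 0 < Real.Gamma (1 + 2 * H) := Real.Gamma_pos_of_pos (by linarith)
  have key : ∀ u ∈ Set.Ioi (0 : ℝ), ENNReal.ofReal (VIntegrand H u) =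
      ∫⁻ s in Set.Ioi (0 : ℝ), ENNReal.ofReal ((1 - Real.cos u) / Real.Gamma (1 + 2 * H)) *
        ENNReal.ofReal (s ^ ((1 + 2 * H) - 1) * Real.exp (-(u * s))) := by
    intro u hu
    have hu' : 0 < u := hu
    have hc : 0 ≤ 1 - Real.cos u := by linarith [Real.cos_le_one u]
    rw [lintegral_const_mul _ (by fun_prop), lintegral_rpow_mul_exp_neg_mul (by linarith) hu,
      ← ENNReal.ofReal_mul (by positivity)]
    congr 1
    rw [VIntegrand, one_div, Real.inv_rpow hu'.le, ← Real.rpow_neg hu'.le,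
      show (-(1 + 2 * H)) = (1 - 2 * H) - (2 : ℕ) by push_cast; ring,
      Real.rpow_sub_natCast hu'.ne']
    field_simp
  rw [setLIntegral_congr_fun measurableSet_Ioi key, lintegral_lintegral_swap (by fun_prop)]
  have key2 : ∀ s ∈ Set.Ioi (0 : ℝ), ∫⁻ u in Set.Ioi (0 : ℝ),
      ENNReal.ofReal ((1 - Real.cos u) / Real.Gamma (1 + 2 * H)) *
        ENNReal.ofReal (s ^ ((1 + 2 * H) - 1) * Real.exp (-(u * s))) =
      ENNReal.ofReal (1 / Real.Gamma (1 + 2 * H)) *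
        ENNReal.ofReal (s ^ (2 * H - 1) / (s ^ 2 + 1)) := by
    intro s hs
    have hs' : 0 < s := hs
    have h3 : ∀ u ∈ Set.Ioi (0 : ℝ), ENNReal.ofReal ((1 - Real.cos u) / Real.Gamma (1 + 2 * H)) *
        ENNReal.ofReal (s ^ ((1 + 2 * H) - 1) * Real.exp (-(u * s))) =
        ENNReal.ofReal (s ^ (2 * H) / Real.Gamma (1 + 2 * H)) *
          ENNReal.ofReal ((1 - Real.cos u) * Real.exp (-(s * u))) := by
      intro u _
      have hc : 0 ≤ 1 - Real.cos u := by linarith [Real.cos_le_one u]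
      rw [← ENNReal.ofReal_mul (by positivity), ← ENNReal.ofReal_mul (by positivity)]
      congr 1
      rw [mul_comm u s, show 1 + 2 * H - 1 = 2 * H by ring]
      ring
    rw [setLIntegral_congr_fun measurableSet_Ioi h3, lintegral_const_mul _ (by fun_prop),
      setLIntegral_ofReal_of_setIntegral_eq measurableSet_Ioi (fun u _ => mul_nonneg
        (by linarith [Real.cos_le_one u]) (Real.exp_pos _).le)
        (integral_one_sub_cos_mul_exp_neg hs') (by positivity),
      ← ENNReal.ofReal_mul (by positivity), ← ENNReal.ofReal_mul (by positivity)]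
    congr 1
    rw [Real.rpow_sub_one hs'.ne']
    field_simp
  rw [setLIntegral_congr_fun measurableSet_Ioi key2, lintegral_const_mul _ (by fun_prop),
    lintegral_rpow_div_one_add_sq (by linarith) (by linarith),
    ← ENNReal.ofReal_mul (by positivity)]
  congr 1
  rw [show 2 * H / 2 = H by ring]
  have := sin_pi_mul_pos hH0 hH1
  field_simp

theorem VIntegrand_nonneg {H u : ℝ} (hu : 0 ≤ u) : 0 ≤ VIntegrand H u :=
  mul_nonneg (div_nonneg (by linarith [Real.cos_le_one u]) (sq_nonneg _)) (Real.rpow_nonneg hu _)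

theorem measurable_VIntegrand (H : ℝ) : Measurable (VIntegrand H) := by
  unfold VIntegrand; fun_prop

theorem integrableOn_VIntegrand {H : ℝ} (hH0 : 0 < H) (hH1 : H < 1) :
    IntegrableOn (VIntegrand H) (Set.Ioi 0) := by
  refine ⟨(measurable_VIntegrand H).aestronglyMeasurable, ?_⟩
  rw [hasFiniteIntegral_iff_ofReal ((ae_restrict_iff' measurableSet_Ioi).2
    (ae_of_all _ fun u hu => VIntegrand_nonneg (le_of_lt hu))), lintegral_VIntegrand hH0 hH1]
  exact ENNReal.ofReal_lt_top

theorem VConst_eq_reflected {H : ℝ} (hH0 : 0 < H) (hH1 : H < 1) :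
    VConst H = Real.pi / (2 * Real.Gamma (1 + 2 * H) * Real.sin (Real.pi * H)) := by
  rw [VConst, integral_eq_lintegral_of_nonneg_ae ((ae_restrict_iff' measurableSet_Ioi).2
    (ae_of_all _ fun u hu => VIntegrand_nonneg (le_of_lt hu)))
    (measurable_VIntegrand H).aestronglyMeasurable, lintegral_VIntegrand hH0 hH1,
    ENNReal.toReal_ofReal]
  have := sin_pi_mul_pos hH0 hH1
  have : 0 < Real.Gamma (1 + 2 * H) := Real.Gamma_pos_of_pos (by linarith)
  positivity

theorem VConst_eq {H : ℝ} (hH0 : 0 < H) (hH1 : H < 1) :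
    VConst H = (if H = 1 / 2 then Real.pi / 2
       else Real.Gamma (2 - 2 * H) * Real.cos (H * Real.pi) / ((1 - 2 * H) * (2 * H))) := by
  rw [VConst_eq_reflected hH0 hH1]
  split_ifs with h
  · subst h
    norm_num
    rw [show Real.pi * (1 / 2) = Real.pi / 2 by ring]
    simp
  · have h12 : 1 - 2 * H ≠ 0 := fun h0 => h (by linarith)
    have hsin := sin_pi_mul_pos hH0 hH1
    -- The reflection formula at `2 * H` has `sin 2πH = 2 sin πH cos πH` in its denominator; the
    -- cosine vanishes in the range only at `H = 1/2`.
    have hcos : Real.cos (Real.pi * H) ≠ 0 := by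
      intro h0
      rcases lt_or_gt_of_ne h with h' | h'
      · exact absurd h0 (Real.cos_pos_of_mem_Ioo
          ⟨by nlinarith [Real.pi_pos], by nlinarith [Real.pi_pos]⟩).ne'
      · exact absurd h0 (Real.cos_neg_of_pi_div_two_lt_of_lt
          (by nlinarith [Real.pi_pos]) (by nlinarith [Real.pi_pos])).ne
    have hG := Real.Gamma_pos_of_pos (show 0 < 2 * H by linarith)
    have hr := Real.Gamma_mul_Gamma_one_sub (2 * H)
    rw [show Real.pi * (2 * H) = 2 * (Real.pi * H) by ring, Real.sin_two_mul] at hr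
    rw [show 2 - 2 * H = (1 - 2 * H) + 1 by ring, Real.Gamma_add_one h12,
      show 1 + 2 * H = 2 * H + 1 by ring, Real.Gamma_add_one (by positivity), mul_comm H Real.pi]
    have : Real.Gamma (1 - 2 * H) = Real.pi /
        (2 * Real.sin (Real.pi * H) * Real.cos (Real.pi * H)) / Real.Gamma (2 * H) := by
      rw [← hr]; field_simp
    rw [this]
    field_simp

/-! ## The spectral kernels -/

/-- The kernel `((1 - cos tu) / u) √m(u)`. -/
def cosKernel (H t u : ℝ) : ℝ := (1 - Real.cos (t * u)) / u * √(specDensity H u)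

/-- The kernel `(sin tu / u) √m(u)`. -/
def sinKernel (H t u : ℝ) : ℝ := Real.sin (t * u) / u * √(specDensity H u)

/-- Half of the spectral density of the variance, `((1 - cos tu) / u²) m(u)`. -/
def varKernel (H t u : ℝ) : ℝ := (1 - Real.cos (t * u)) / u ^ 2 * specDensity H u

theorem specDensity_nonneg (H u : ℝ) : 0 ≤ specDensity H u :=
  div_nonneg (Real.rpow_nonneg (abs_nonneg _) _) (by positivity)

@[fun_prop]
theorem measurable_specDensity (H : ℝ) : Measurable (specDensity H) := by
  unfold specDensity; fun_prop

@[fun_prop]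
theorem measurable_cosKernel (H t : ℝ) : Measurable (cosKernel H t) := by
  unfold cosKernel; fun_prop

@[fun_prop]
theorem measurable_sinKernel (H t : ℝ) : Measurable (sinKernel H t) := by
  unfold sinKernel; fun_prop

theorem varKernel_zero (H : ℝ) : varKernel H 0 = 0 := by
  ext u; simp [varKernel]

theorem varKernel_eq_comp_abs (H : ℝ) {t : ℝ} (ht : t ≠ 0) (u : ℝ) :
    varKernel H t u = |t| ^ (1 + 2 * H) / (2 * Real.pi) * VIntegrand H (|t| * |u|) := by
  have ht' : 0 < |t| := abs_pos.2 ht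
  rw [varKernel, VIntegrand, specDensity, ← abs_mul, Real.cos_abs, abs_mul,
    Real.mul_rpow ht'.le (abs_nonneg u), mul_pow, sq_abs u,
    show 1 + 2 * H = (2 : ℕ) - (1 - 2 * H) by push_cast; ring, Real.rpow_sub ht',
    Real.rpow_natCast]
  have h1 : 0 < |t| ^ (1 - 2 * H) := Real.rpow_pos_of_pos ht' _
  field_simp

theorem integrable_comp_abs {f : ℝ → ℝ} (hf : IntegrableOn f (Set.Ioi 0)) :
    Integrable fun x => f |x| := by
  have h : IntegrableOn (fun x => f |x|) (Set.Ioi 0) :=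
    hf.congr_fun (fun x hx => by rw [abs_of_pos (show 0 < x from hx)]) measurableSet_Ioi
  have h' : IntegrableOn (fun x => f |x|) (Set.Iio 0) := by
    have := (Measure.measurePreserving_neg (volume : Measure ℝ)).integrableOn_comp_preimage
      (Homeomorph.neg ℝ).measurableEmbedding (f := fun x => f |x|) (s := Set.Ioi 0)
    simpa [Function.comp_def] using this.2 h
  rw [← integrableOn_univ, ← Set.Iic_union_Ioi (a := (0 : ℝ))]
  exact (Iff.mpr integrableOn_Iic_iff_integrableOn_Iio h').union h

theorem integrable_varKernel {H : ℝ} (hH0 : 0 < H) (hH1 : H < 1) (t : ℝ) :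
    Integrable (varKernel H t) := by
  rcases eq_or_ne t 0 with rfl | ht
  · rw [varKernel_zero]; exact integrable_zero _ _ _
  · have h : varKernel H t =
        fun u => |t| ^ (1 + 2 * H) / (2 * Real.pi) * (fun v => VIntegrand H (|t| * v)) |u| :=
      funext (varKernel_eq_comp_abs H ht)
    rw [h]
    refine Integrable.const_mul
      (integrable_comp_abs (f := fun v => VIntegrand H (|t| * v)) ?_) _
    rw [integrableOn_Ioi_comp_mul_left_iff _ _ (abs_pos.2 ht), mul_zero]
    exact integrableOn_VIntegrand hH0 hH1

/-- The substitution `v = |t| u` costs one factor `|t|`, and evenness doubles the half-line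
integral, so the prefactor `|t|^{1+2H}/(2π)` becomes `|t|^{2H}/π`. -/
theorem integral_varKernel {H : ℝ} (hH0 : 0 < H) (t : ℝ) :
    ∫ u, varKernel H t u = VConst H / Real.pi * |t| ^ (2 * H) := by
  rcases eq_or_ne t 0 with rfl | ht
  · rw [varKernel_zero, abs_zero, Real.zero_rpow (by positivity)]; simp
  · simp_rw [varKernel_eq_comp_abs H ht]
    rw [integral_const_mul, integral_comp_abs (f := fun v => VIntegrand H (|t| * v)),
      integral_comp_mul_left_Ioi _ _ (abs_pos.2 ht), mul_zero, VConst, smul_eq_mul,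
      Real.rpow_add (abs_pos.2 ht), Real.rpow_one]
    have := abs_pos.2 ht
    field_simp

/-- The two kernels are the real and imaginary parts of `(1 - e^{-itu}) √m / u`. The identity is the
polarization of `|1 - e^{-itu}|² = 2 (1 - cos tu)`. -/
theorem cosKernel_mul_add_sinKernel_mul (H t s u : ℝ) :
    cosKernel H t u * cosKernel H s u + sinKernel H t u * sinKernel H s u =
      varKernel H t u + varKernel H s u - varKernel H (t - s) u := by
  have h := Real.mul_self_sqrt (specDensity_nonneg H u)
  simp only [cosKernel, sinKernel, varKernel, sub_mul t s u, Real.cos_sub]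
  linear_combination (((1 - Real.cos (t * u)) * (1 - Real.cos (s * u)) +
    Real.sin (t * u) * Real.sin (s * u)) / u ^ 2) * h

theorem memLp_two_cosKernel {H : ℝ} (hH0 : 0 < H) (hH1 : H < 1) (t : ℝ) :
    MemLp (cosKernel H t) 2 := by
  rw [memLp_two_iff_integrable_sq (by fun_prop)]
  refine ((integrable_varKernel hH0 hH1 t).const_mul 2).mono' (by fun_prop) (ae_of_all _ fun u => ?_)
  rw [Real.norm_of_nonneg (sq_nonneg _)]
  -- On the diagonal the identity says that the squares of the two kernels add up to `2 * varKernel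
  -- H t u`.
  have h := cosKernel_mul_add_sinKernel_mul H t t u
  rw [sub_self, varKernel_zero, Pi.zero_apply] at h
  nlinarith [mul_self_nonneg (sinKernel H t u)]

theorem memLp_two_sinKernel {H : ℝ} (hH0 : 0 < H) (hH1 : H < 1) (t : ℝ) :
    MemLp (sinKernel H t) 2 := by
  rw [memLp_two_iff_integrable_sq (by fun_prop)]
  refine ((integrable_varKernel hH0 hH1 t).const_mul 2).mono' (by fun_prop) (ae_of_all _ fun u => ?_)
  rw [Real.norm_of_nonneg (sq_nonneg _)]
  have h := cosKernel_mul_add_sinKernel_mul H t t u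
  rw [sub_self, varKernel_zero, Pi.zero_apply] at h
  nlinarith [mul_self_nonneg (cosKernel H t u)]

theorem integral_cosKernel_mul_add_integral_sinKernel_mul {H : ℝ} (hH0 : 0 < H) (hH1 : H < 1)
    (t s : ℝ) :
    (∫ u, cosKernel H t u * cosKernel H s u) + ∫ u, sinKernel H t u * sinKernel H s u =
      VConst H / Real.pi * (|t| ^ (2 * H) + |s| ^ (2 * H) - |t - s| ^ (2 * H)) := by
  have hi := integrable_varKernel hH0 hH1
  rw [← integral_add (f := fun u => cosKernel H t u * cosKernel H s u)
      (g := fun u => sinKernel H t u * sinKernel H s u) ((memLp_two_cosKernel hH0 hH1 t).integrable_mul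
      (memLp_two_cosKernel hH0 hH1 s)) ((memLp_two_sinKernel hH0 hH1 t).integrable_mul
      (memLp_two_sinKernel hH0 hH1 s))]
  simp_rw [cosKernel_mul_add_sinKernel_mul]
  rw [integral_sub (f := fun u => varKernel H t u + varKernel H s u) ((hi t).add (hi s)) (hi _), integral_add (hi t) (hi s)]
  simp_rw [integral_varKernel hH0]
  ring

/-! ## Hermite polynomials and Hermite functions -/

/-- The physicists' Hermite polynomials, `H₀ = 1`, `H_{n+1} = 2 X H_n - H_n'`. -/
def hermitePoly : ℕ → Polynomial ℝ
  | 0 => 1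
  | n + 1 => 2 * Polynomial.X * hermitePoly n - Polynomial.derivative (hermitePoly n)

/-- Differentiation lowers the degree within the family. This closes the induction for orthogonality
and makes the span stable under multiplication by `X`. -/
theorem derivative_hermitePoly_succ (n : ℕ) :
    Polynomial.derivative (hermitePoly (n + 1)) =
      Polynomial.C (2 * (n + 1 : ℝ)) * hermitePoly n := by
  have h2 : (2 : Polynomial ℝ) = Polynomial.C 2 := rfl
  induction n with
  | zero => simp [hermitePoly, h2]
  | succ n ih =>
    rw [hermitePoly, Polynomial.derivative_sub, ih]
    simp only [Polynomial.derivative_mul, Polynomial.derivative_X, Polynomial.derivative_C,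
      Polynomial.derivative_ofNat, zero_mul, zero_add, mul_one, ih]
    conv_rhs => rw [hermitePoly]
    simp only [h2, Nat.cast_add, Nat.cast_one, Polynomial.C_mul, Polynomial.C_add, Polynomial.C_1]
    rw [hermitePoly]
    simp only [h2]
    ring

theorem iteratedDeriv_gaussian (n : ℕ) :
    iteratedDeriv n (fun x : ℝ => Real.exp (-x ^ 2)) =
      fun x => (-1) ^ n * (hermitePoly n).eval x * Real.exp (-x ^ 2) := by
  induction n with
  | zero => ext x; simp [hermitePoly]
  | succ n ih =>
    ext x
    rw [iteratedDeriv_succ, ih]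
    have h1 : HasDerivAt (fun x : ℝ => Real.exp (-x ^ 2)) (Real.exp (-x ^ 2) * (-(2 * x))) x := by
      simpa using ((hasDerivAt_pow 2 x).neg).exp
    have h2 := (((hermitePoly n).hasDerivAt x).const_mul ((-1 : ℝ) ^ n)).mul h1
    refine h2.deriv.trans ?_
    simp only [hermitePoly, Polynomial.eval_sub, Polynomial.eval_mul, Polynomial.eval_X,
      Polynomial.eval_ofNat]
    ring

/-- The normalizing constant of `hermiteFun`. -/
def hermiteNorm (n : ℕ) : ℝ :=
  1 / (Real.pi ^ (1 / 4 : ℝ) * 2 ^ ((n : ℝ) / 2) * √(n.factorial : ℝ))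

theorem hermiteNorm_pos (n : ℕ) : 0 < hermiteNorm n := by
  unfold hermiteNorm
  have := n.factorial_pos
  have := Real.pi_pos
  positivity

theorem hermiteNorm_sq (n : ℕ) :
    hermiteNorm n ^ 2 * (√Real.pi * 2 ^ n * n.factorial) = 1 := by
  have h1 : (Real.pi ^ (1 / 4 : ℝ)) ^ 2 = √Real.pi := by
    rw [← Real.rpow_natCast, ← Real.rpow_mul Real.pi_pos.le, Real.sqrt_eq_rpow]; norm_num
  have h2 : ((2 : ℝ) ^ ((n : ℝ) / 2)) ^ 2 = 2 ^ n := by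
    rw [← Real.rpow_natCast, ← Real.rpow_mul two_pos.le, ← Real.rpow_natCast]
    congr 1; push_cast; ring
  have h3 : √(n.factorial : ℝ) ^ 2 = n.factorial := Real.sq_sqrt (Nat.cast_nonneg _)
  have h4 : (n.factorial : ℝ) ≠ 0 := Nat.cast_ne_zero.2 n.factorial_ne_zero
  have h5 : √Real.pi ≠ 0 := (Real.sqrt_pos.2 Real.pi_pos).ne'
  rw [hermiteNorm, div_pow, mul_pow, mul_pow, h1, h2, h3, one_pow]
  field_simp

theorem hermiteFun_eq (n : ℕ) (x : ℝ) :
    hermiteFun n x = hermiteNorm n * ((hermitePoly n).eval x * Real.exp (-x ^ 2 / 2)) := by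
  have h1 : Real.exp (x ^ 2 / 2) * Real.exp (-x ^ 2) = Real.exp (-x ^ 2 / 2) := by
    rw [← Real.exp_add]; ring_nf
  have h2 : ((-1 : ℝ) ^ n) * (-1) ^ n = 1 := by rw [← mul_pow]; simp
  rw [hermiteFun, iteratedDeriv_gaussian, hermiteNorm, ← h1]
  linear_combination (Real.exp (x ^ 2 / 2) * Real.exp (-x ^ 2) * (hermitePoly n).eval x /
    (Real.pi ^ (1 / 4 : ℝ) * 2 ^ ((n : ℝ) / 2) * √(n.factorial : ℝ))) * h2

theorem integrable_eval_mul_exp_neg_mul_sq (p : Polynomial ℝ) {b : ℝ} (hb : 0 < b) :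
    Integrable (fun x : ℝ => p.eval x * Real.exp (-b * x ^ 2)) := by
  induction p using Polynomial.induction_on' with
  | add p q hp hq => simpa only [Polynomial.eval_add, add_mul] using! hp.add hq
  | monomial n a =>
    have h := integrable_rpow_mul_exp_neg_mul_sq hb
      (show (-1 : ℝ) < n by linarith [Nat.cast_nonneg (α := ℝ) n])
    simp only [Real.rpow_natCast] at h
    simpa only [Polynomial.eval_monomial, mul_assoc] using! h.const_mul a

/-- Integration by parts, since `H_{n+1} e^{-x²} = -(H_n e^{-x²})'`. -/
theorem integral_hermitePoly_mul_succ (p : Polynomial ℝ) (n : ℕ) :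
    ∫ x : ℝ, p.eval x * (hermitePoly (n + 1)).eval x * Real.exp (-1 * x ^ 2) =
      ∫ x : ℝ, (Polynomial.derivative p).eval x * (hermitePoly n).eval x *
        Real.exp (-1 * x ^ 2) := by
  have hi := fun q : Polynomial ℝ => integrable_eval_mul_exp_neg_mul_sq q one_pos
  have h := integral_eq_zero_of_hasDerivAt_of_integrable
    (f := fun x => (p * hermitePoly n).eval x * Real.exp (-1 * x ^ 2))
    (f' := fun x => (Polynomial.derivative p * hermitePoly n).eval x * Real.exp (-1 * x ^ 2) -
      (p * hermitePoly (n + 1)).eval x * Real.exp (-1 * x ^ 2)) (fun x => ?_)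
    ((hi _).sub (hi _)) (hi _)
  · rw [integral_sub (hi _) (hi _)] at h
    simp only [Polynomial.eval_mul] at h
    linarith
  · have h1 : HasDerivAt (fun x : ℝ => Real.exp (-1 * x ^ 2))
        (Real.exp (-1 * x ^ 2) * (-1 * (2 * x))) x := by
      simpa using ((hasDerivAt_pow 2 x).const_mul (-1)).exp
    convert! ((p * hermitePoly n).hasDerivAt x).mul h1 using 1
    simp only [hermitePoly, Polynomial.eval_sub, Polynomial.eval_mul, Polynomial.eval_X,
      Polynomial.eval_ofNat, Polynomial.derivative_mul, Polynomial.eval_add]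
    ring

theorem integral_hermitePoly_mul_hermitePoly (m n : ℕ) :
    ∫ x : ℝ, (hermitePoly m).eval x * (hermitePoly n).eval x * Real.exp (-1 * x ^ 2) =
      if m = n then √Real.pi * 2 ^ n * n.factorial else 0 := by
  induction n generalizing m with
  | zero =>
    cases m with
    | zero => simpa [hermitePoly] using integral_gaussian 1
    | succ m =>
      -- By symmetry the derivative can be moved onto `H₀ = 1`, where it vanishes.
      simp_rw [mul_comm ((hermitePoly (m + 1)).eval _)]
      rw [integral_hermitePoly_mul_succ]
      simp [hermitePoly]
  | succ n ih =>
    rw [integral_hermitePoly_mul_succ]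
    cases m with
    | zero => simp [hermitePoly]
    | succ m =>
      simp_rw [derivative_hermitePoly_succ, Polynomial.eval_mul, Polynomial.eval_C, mul_assoc,
        integral_const_mul]
      simp_rw [← mul_assoc, ih]
      by_cases h : m = n
      · subst h
        simp [pow_succ, Nat.factorial_succ]
        ring
      · simp [h]

theorem memLp_two_eval_mul_gaussian (p : Polynomial ℝ) :
    MemLp (fun x : ℝ => p.eval x * Real.exp (-x ^ 2 / 2)) 2 := by
  have hm : Measurable fun x : ℝ => p.eval x := p.continuous.measurable
  rw [memLp_two_iff_integrable_sq (by fun_prop)]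
  convert integrable_eval_mul_exp_neg_mul_sq (p * p) one_pos using 2 with x
  rw [mul_pow, ← Real.exp_nat_mul, Polynomial.eval_mul, sq]
  congr 2
  push_cast; ring

theorem memLp_two_hermiteFun (n : ℕ) : MemLp (hermiteFun n) 2 := by
  have h : hermiteFun n = fun x => hermiteNorm n *
      ((hermitePoly n).eval x * Real.exp (-x ^ 2 / 2)) := funext (hermiteFun_eq n)
  rw [h]
  exact (memLp_two_eval_mul_gaussian _).const_mul _

theorem integral_hermiteFun_mul_hermiteFun (m n : ℕ) :
    ∫ x, hermiteFun m x * hermiteFun n x = if m = n then 1 else 0 := by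
  have h : ∀ x, hermiteFun m x * hermiteFun n x = hermiteNorm m * hermiteNorm n *
      ((hermitePoly m).eval x * (hermitePoly n).eval x * Real.exp (-1 * x ^ 2)) := by
    intro x
    have : Real.exp (-x ^ 2 / 2) * Real.exp (-x ^ 2 / 2) = Real.exp (-1 * x ^ 2) := by
      rw [← Real.exp_add]; ring_nf
    rw [hermiteFun_eq, hermiteFun_eq, ← this]
    ring
  simp_rw [h]
  rw [integral_const_mul, integral_hermitePoly_mul_hermitePoly]
  split_ifs with hmn
  · subst hmn
    rw [← sq, hermiteNorm_sq]
  · rw [mul_zero]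

/-! ## Completeness of the Hermite functions -/

/-- The span contains `1` and is stable under multiplication by `X`, because `X H_n = (H_{n+1} +
H_n') / 2`. -/
theorem span_hermitePoly : Submodule.span ℝ (Set.range hermitePoly) = ⊤ := by
  set S := Submodule.span ℝ (Set.range hermitePoly) with hS
  have hmem : ∀ n, hermitePoly n ∈ S := fun n => Submodule.subset_span ⟨n, rfl⟩
  have hder : ∀ n, Polynomial.derivative (hermitePoly n) ∈ S := by
    intro n
    cases n with
    | zero => simp [hermitePoly]
    | succ n =>
      rw [derivative_hermitePoly_succ, Polynomial.C_mul']
      exact S.smul_mem _ (hmem n)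
  have hX : ∀ p ∈ S, Polynomial.X * p ∈ S := by
    intro p hp
    induction hp using Submodule.span_induction with
    | mem p hp =>
      obtain ⟨n, rfl⟩ := hp
      have h : Polynomial.X * hermitePoly n =
          (1 / 2 : ℝ) • (hermitePoly (n + 1) + Polynomial.derivative (hermitePoly n)) := by
        rw [hermitePoly, sub_add_cancel, mul_assoc, ← Polynomial.C_mul', ← mul_assoc,
          show (2 : Polynomial ℝ) = Polynomial.C 2 from rfl, ← Polynomial.C_mul]
        norm_num
      rw [h]
      exact S.smul_mem _ (S.add_mem (hmem _) (hder _))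
    | zero => simp
    | add p q _ _ hp hq => rw [mul_add]; exact S.add_mem hp hq
    | smul a p _ hp => rw [mul_smul_comm]; exact S.smul_mem _ hp
  refine eq_top_iff.2 fun p _ => ?_
  induction p using Polynomial.induction_on' with
  | add p q hp hq => exact S.add_mem (hp trivial) (hq trivial)
  | monomial n a =>
    rw [← Polynomial.C_mul_X_pow_eq_monomial, Polynomial.C_mul']
    refine S.smul_mem _ ?_
    induction n with
    | zero => simpa [hermitePoly] using hmem 0
    | succ n ih => rw [pow_succ']; exact hX _ (ih trivial)

/-- Every smooth compactly supported test function is the Fourier transform of some Schwartz `ψ`.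
Moving the transform across the integral pairs `f` with it as `∫ f̂ ψ = 0`. -/
theorem ae_eq_zero_of_fourier_eq_zero {f : ℝ → ℂ} (hf : Integrable f)
    (h : ∀ ξ, FourierTransform.fourier f ξ = 0) : ∀ᵐ x, f x = 0 := by
  refine ae_eq_zero_of_integral_contDiff_smul_eq_zero hf.locallyIntegrable fun g hg hgc => ?_
  have hgc' : HasCompactSupport fun x => (g x : ℂ) := hgc.comp_left (g := fun x : ℝ => (x : ℂ)) rfl
  have hg' : ContDiff ℝ (↑(⊤ : ℕ∞)) fun x => (g x : ℂ) := Complex.ofRealCLM.contDiff.comp hg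
  let φ : 𝓢(ℝ, ℂ) := hgc'.toSchwartzMap hg'
  let ψ : 𝓢(ℝ, ℂ) := FourierTransformInv.fourierInv φ
  have hψ : FourierTransform.fourier ψ = φ := FourierTransform.fourier_fourierInv_eq φ
  have key : ∫ ξ : ℝ, FourierTransform.fourier f ξ • ψ ξ =
      ∫ x : ℝ, f x • FourierTransform.fourier (⇑ψ) x := by
    simpa using! VectorFourier.integral_fourierIntegral_smul_eq_flip (L := innerₗ ℝ)
      (μ := volume) (ν := volume) Real.continuous_fourierChar continuous_inner hf ψ.integrable
  simp only [h, zero_smul, integral_zero, ← SchwartzMap.fourier_coe, hψ] at key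
  rw [key]
  refine integral_congr_ae (ae_of_all _ fun x => ?_)
  change g x • f x = f x • (g x : ℂ)
  rw [Complex.real_smul, smul_eq_mul, mul_comm]

theorem memLp_two_exp_abs_mul_gaussian (c : ℝ) :
    MemLp (fun x : ℝ => Real.exp (|c * x|) * Real.exp (-x ^ 2 / 2)) 2 := by
  rw [memLp_two_iff_integrable_sq (by fun_prop)]
  refine ((integrable_exp_neg_mul_sq (one_half_pos (α := ℝ))).const_mul
    (Real.exp (2 * c ^ 2))).mono' (by fun_prop) (ae_of_all _ fun x => ?_)
  rw [Real.norm_of_nonneg (sq_nonneg _), ← Real.exp_add, ← Real.exp_nat_mul, ← Real.exp_add]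
  refine Real.exp_le_exp.2 ?_
  push_cast
  rw [abs_mul]
  -- Completing the square gives `2|c||x| ≤ 2c² + x²/2`, whence the constant `exp (2c²)` above.
  nlinarith [sq_nonneg (2 * |c| - |x|), sq_abs c, sq_abs x]

theorem integral_mul_eval_mul_gaussian_eq_zero {f : ℝ → ℝ} (hf : MemLp f 2)
    (h : ∀ n, ∫ x, f x * hermiteFun n x = 0) (p : Polynomial ℝ) :
    ∫ x, f x * (p.eval x * Real.exp (-x ^ 2 / 2)) = 0 := by
  have hi : ∀ p : Polynomial ℝ, Integrable fun x => f x * (p.eval x * Real.exp (-x ^ 2 / 2)) :=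
    fun p => hf.integrable_mul (memLp_two_eval_mul_gaussian p)
  have hp : p ∈ Submodule.span ℝ (Set.range hermitePoly) := by rw [span_hermitePoly]; trivial
  induction hp using Submodule.span_induction with
  | mem p hp =>
    obtain ⟨n, rfl⟩ := hp
    have := h n
    simp_rw [hermiteFun_eq, mul_left_comm (f _) (hermiteNorm n)] at this
    rw [integral_const_mul] at this
    exact (mul_eq_zero.1 this).resolve_left (hermiteNorm_pos n).ne'
  | zero => simp
  | add p q _ _ hp hq =>
    simp_rw [Polynomial.eval_add, add_mul, mul_add]
    rw [integral_add (hi p) (hi q), hp, hq, add_zero]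
  | smul a p _ hp =>
    simp_rw [Polynomial.eval_smul, smul_eq_mul, mul_assoc a, mul_left_comm _ a]
    rw [integral_const_mul, hp, mul_zero]

/-- All moments of `G = f e^{-x²/2}` vanish. `G` has exponential moments of every order, so its
Fourier transform is the sum of its moment series and is zero. -/
theorem ae_eq_zero_of_integral_mul_hermiteFun_eq_zero {f : ℝ → ℝ} (hf : MemLp f 2)
    (h : ∀ n, ∫ x, f x * hermiteFun n x = 0) : ∀ᵐ x, f x = 0 := by
  set G : ℝ → ℝ := fun x => f x * Real.exp (-x ^ 2 / 2) with hG
  have hGi : Integrable G := by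
    simpa using! hf.integrable_mul (memLp_two_eval_mul_gaussian 1)
  have hmom : ∀ n : ℕ, ∫ x, x ^ n * G x = 0 := by
    intro n
    have := integral_mul_eval_mul_gaussian_eq_zero hf h (Polynomial.X ^ n)
    simpa [hG, mul_left_comm] using this
  have hfour : ∀ ξ, FourierTransform.fourier (fun x => (G x : ℂ)) ξ = 0 := by
    intro ξ
    set c : ℝ := -2 * Real.pi * ξ with hc
    -- The sum of the absolute values of the terms of the exponential series, needed for termwise
    -- integration.
    have hexp : Integrable fun x => Real.exp |c * x| * |G x| := by
      have := (hf.abs).integrable_mul (memLp_two_exp_abs_mul_gaussian c)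
      refine this.congr (ae_of_all _ fun x => ?_)
      simp only [hG, Pi.mul_apply, abs_mul, Real.abs_exp, Pi.abs_apply]
      ring
    have hs : HasSum (fun n : ℕ => ∫ x : ℝ, ((c * x : ℝ) * Complex.I) ^ n / (n.factorial : ℂ) * G x)
        (∫ x : ℝ, Complex.exp ((c * x : ℝ) * Complex.I) * G x) := by
      refine hasSum_integral_of_dominated_convergence
        (fun n x => |c * x| ^ n / n.factorial * |G x|) (fun n => ?_) (fun n => ae_of_all _ fun x => ?_)
        (ae_of_all _ fun x => ?_) ?_ (ae_of_all _ fun x => ?_)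
      · have := Complex.measurable_ofReal.aestronglyMeasurable.comp_aemeasurable
          hGi.aestronglyMeasurable.aemeasurable
        exact AEStronglyMeasurable.mul (by fun_prop) this
      · simp
      · exact (Real.summable_pow_div_factorial _).mul_right _
      · refine hexp.congr (ae_of_all _ fun x => ?_)
        simp only []
        rw [tsum_mul_right, Real.exp_eq_exp_ℝ, NormedSpace.exp_eq_tsum_div]
      · have := NormedSpace.expSeries_div_hasSum_exp (((c * x : ℝ) : ℂ) * Complex.I)
        rw [← Complex.exp_eq_exp_ℂ] at this
        exact this.mul_right _
    have hz : ∀ n : ℕ, ∫ x : ℝ, ((c * x : ℝ) * Complex.I) ^ n / (n.factorial : ℂ) * G x = 0 := by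
      intro n
      have : ∀ x : ℝ, ((c * x : ℝ) * Complex.I) ^ n / (n.factorial : ℂ) * G x =
          (c * Complex.I) ^ n / (n.factorial : ℂ) * ((x ^ n * G x : ℝ) : ℂ) := by
        intro x; push_cast; ring
      simp_rw [this]
      rw [integral_const_mul, integral_complex_ofReal, hmom]
      simp
    simp_rw [hz] at hs
    rw [Real.fourier_real_eq_integral_exp_smul]
    refine Eq.trans ?_ (hs.unique hasSum_zero)
    refine integral_congr_ae (ae_of_all _ fun x => ?_)
    simp only [smul_eq_mul, hc]
    congr 4
    ring
  filter_upwards [ae_eq_zero_of_fourier_eq_zero hGi.ofReal hfour] with x hx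
  have : G x = 0 := Complex.ofReal_eq_zero.1 hx
  exact (mul_eq_zero.1 this).resolve_right (Real.exp_pos _).ne'

theorem inner_toLp_eq_integral_inner {α E : Type*} [MeasurableSpace α] [NormedAddCommGroup E]
    [InnerProductSpace ℝ E] {ν : Measure α} {f g : α → E} (hf : MemLp f 2 ν) (hg : MemLp g 2 ν) :
    inner ℝ (hf.toLp f) (hg.toLp g) = ∫ x, inner ℝ (f x) (g x) ∂ν := by
  rw [L2.inner_def]
  refine integral_congr_ae ?_
  filter_upwards [hf.coeFn_toLp, hg.coeFn_toLp] with x h1 h2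
  rw [h1, h2]

theorem inner_toLp {α : Type*} [MeasurableSpace α] {ν : Measure α} {f g : α → ℝ}
    (hf : MemLp f 2 ν) (hg : MemLp g 2 ν) :
    inner ℝ (hf.toLp f) (hg.toLp g) = ∫ x, f x * g x ∂ν := by
  simp [inner_toLp_eq_integral_inner, mul_comm]

theorem orthonormal_hermiteFun :
    Orthonormal ℝ fun n => (memLp_two_hermiteFun n).toLp (hermiteFun n) := by
  rw [orthonormal_iff_ite]
  intro i j
  rw [inner_toLp, integral_hermiteFun_mul_hermiteFun]

/-- The Hermite functions, as a Hilbert basis of `L²(ℝ)`. -/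
def hermiteBasis : HilbertBasis ℕ ℝ (Lp ℝ 2 (volume : Measure ℝ)) :=
  HilbertBasis.mkOfOrthogonalEqBot orthonormal_hermiteFun <| by
    refine (Submodule.eq_bot_iff _).2 fun f hf => ?_
    rw [Submodule.mem_orthogonal'] at hf
    have hz := ae_eq_zero_of_integral_mul_hermiteFun_eq_zero (Lp.memLp f) fun n => by
      rw [← inner_toLp (Lp.memLp f) (memLp_two_hermiteFun n), Lp.toLp_coeFn]
      exact hf _ (Submodule.subset_span ⟨n, rfl⟩)
    exact Lp.eq_zero_iff_ae_eq_zero.2 hz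

theorem hasSum_integral_mul_hermiteFun {f g : ℝ → ℝ} (hf : MemLp f 2) (hg : MemLp g 2) :
    HasSum (fun n => (∫ u, f u * hermiteFun n u) * ∫ u, g u * hermiteFun n u)
      (∫ u, f u * g u) := by
  have h := hermiteBasis.hasSum_inner_mul_inner (hf.toLp f) (hg.toLp g)
  rw [inner_toLp] at h
  refine h.congr_fun fun n => ?_
  have hb : hermiteBasis n = (memLp_two_hermiteFun n).toLp (hermiteFun n) := by
    simp [hermiteBasis]
  rw [hb, inner_toLp, inner_toLp]
  simp_rw [mul_comm (g _)]

theorem toLp_finsetSum {α ι : Type*} [MeasurableSpace α] {ν : Measure α} {f : ι → α → ℝ}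
    (hf : ∀ i, MemLp (f i) 2 ν) (s : Finset ι) :
    (memLp_finsetSum s fun i _ => hf i).toLp (fun ω => ∑ i ∈ s, f i ω) =
      ∑ i ∈ s, (hf i).toLp (f i) := by
  refine Lp.ext ?_
  have h : ∀ᵐ ω ∂ν, ∀ i ∈ s, (hf i).toLp (f i) ω = f i ω :=
    (ae_ball_iff s.countable_toSet).2 fun i _ => (hf i).coeFn_toLp
  filter_upwards [(memLp_finsetSum s fun i _ => hf i).coeFn_toLp,
    Lp.coeFn_finsetSum s fun i => (hf i).toLp (f i), h] with ω h1 h2 h3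
  rw [h1, h2, Finset.sum_apply]
  exact Finset.sum_congr rfl fun i hi => (h3 i hi).symm

/-! ## The white noise space -/

@[fun_prop]
theorem measurable_pairing (s : 𝓢(ℝ, ℝ)) : Measurable (pairing s) :=
  measurable_iff_comap_le.2
    (le_iSup (fun s : 𝓢(ℝ, ℝ) => MeasurableSpace.comap (pairing s) inferInstance) s)

theorem pairing_add (s s' : 𝓢(ℝ, ℝ)) (ω : TemperedDual) :
    pairing (s + s') ω = pairing s ω + pairing s' ω :=
  map_add (show 𝓢(ℝ, ℝ) →L[ℝ] ℝ from ω) s s'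

theorem pairing_smul (c : ℝ) (s : 𝓢(ℝ, ℝ)) (ω : TemperedDual) :
    pairing (c • s) ω = c * pairing s ω :=
  map_smul (show 𝓢(ℝ, ℝ) →L[ℝ] ℝ from ω) c s

theorem integrable_exp_mul_schwartz (s : 𝓢(ℝ, ℝ)) (u : ℝ) :
    Integrable fun t : ℝ => Complex.exp (-(Complex.I * u * t)) * (s t : ℂ) := by
  refine s.integrable.ofReal.bdd_mul (c := 1) (by fun_prop) (ae_of_all _ fun t => ?_)
  rw [Complex.norm_exp]
  simp

theorem fourierHat_add (s s' : 𝓢(ℝ, ℝ)) (u : ℝ) :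
    fourierHat (s + s') u = fourierHat s u + fourierHat s' u := by
  simp only [fourierHat]
  rw [← integral_add (integrable_exp_mul_schwartz s u) (integrable_exp_mul_schwartz s' u)]
  simp [mul_add]

theorem fourierHat_smul (c : ℝ) (s : 𝓢(ℝ, ℝ)) (u : ℝ) :
    fourierHat (c • s) u = c * fourierHat s u := by
  simp only [fourierHat]
  rw [← integral_const_mul]
  simp [mul_left_comm]

theorem stronglyMeasurable_fourierHat (s : 𝓢(ℝ, ℝ)) : StronglyMeasurable (fourierHat s) := by
  refine StronglyMeasurable.integral_prod_right (Continuous.stronglyMeasurable ?_)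
  have := s.continuous
  simp only [Function.uncurry_def]
  fun_prop

/-! ### Real Gaussian laws and their stability in `L²` -/

section Gaussian

variable {Ω : Type*} [MeasurableSpace Ω] {P : Measure Ω}

theorem map_eq_gaussianReal_of_integral_exp [IsProbabilityMeasure P] {X : Ω → ℝ} (hX : AEMeasurable X P) (v : NNReal)
    (h : ∀ t : ℝ, ∫ ω, Complex.exp (Complex.I * ((t * X ω : ℝ) : ℂ)) ∂P =
      Complex.exp (-((t ^ 2 * v : ℝ) : ℂ) / 2)) :
    P.map X = gaussianReal 0 v := by
  have := Measure.isProbabilityMeasure_map hX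
  refine Measure.ext_of_charFun (funext fun t => ?_)
  rw [charFun_apply_real, integral_map hX (by fun_prop), charFun_gaussianReal]
  have h1 := h t
  push_cast at h1
  simp_rw [mul_comm Complex.I] at h1
  rw [h1]
  congr 1
  push_cast
  ring

theorem memLp_two_of_map_eq_gaussianReal {X : Ω → ℝ} (hX : AEMeasurable X P) {v : NNReal}
    (h : P.map X = gaussianReal 0 v) : MemLp X 2 P := by
  have h1 : MemLp id 2 (P.map X) := by rw [h]; exact memLp_id_gaussianReal 2
  exact (memLp_map_measure_iff (by fun_prop) hX).1 h1

theorem integral_eq_zero_of_map_eq_gaussianReal {X : Ω → ℝ} (hX : AEMeasurable X P) {v : NNReal}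
    (h : P.map X = gaussianReal 0 v) : ∫ ω, X ω ∂P = 0 := by
  have h1 : ∫ x, id x ∂(P.map X) = 0 := by
    rw [h]; exact integral_id_gaussianReal
  rwa [integral_map hX (by fun_prop)] at h1

theorem integral_sq_of_map_eq_gaussianReal {X : Ω → ℝ} (hX : AEMeasurable X P) {v : NNReal}
    (h : P.map X = gaussianReal 0 v) : ∫ ω, X ω ^ 2 ∂P = v := by
  have h1 : ∫ x, x ^ 2 ∂(P.map X) = v := by
    rw [h, ← variance_id_gaussianReal (μ := 0) (v := v), variance_of_integral_eq_zero
      (X := id) aemeasurable_id integral_id_gaussianReal]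
    rfl
  rwa [integral_map hX (by fun_prop)] at h1

/-- The map is 1-Lipschitz: `|e^{ix} - e^{iy}| ≤ |x - y|`, and the `L¹` norm is at most the `L²`
norm under a probability measure. -/
theorem continuous_integral_exp [IsProbabilityMeasure P] :
    Continuous fun X : Lp ℝ 2 P => ∫ ω, Complex.exp (Complex.I * (X ω : ℂ)) ∂P := by
  have hm : ∀ X : Lp ℝ 2 P, AEStronglyMeasurable
      (fun ω => Complex.exp (Complex.I * (X ω : ℂ))) P := fun X =>
    (by fun_prop : Measurable fun x : ℝ => Complex.exp (Complex.I * (x : ℂ))).aestronglyMeasurable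
      |>.comp_aemeasurable (Lp.aestronglyMeasurable X).aemeasurable
  have hi : ∀ X : Lp ℝ 2 P, Integrable (fun ω => Complex.exp (Complex.I * (X ω : ℂ))) P := fun X =>
    (integrable_const (1 : ℝ)).mono' (hm X) (ae_of_all _ fun ω => by
      rw [mul_comm, Complex.norm_exp_ofReal_mul_I])
  refine (LipschitzWith.of_dist_le_mul (K := 1) fun X Y => ?_).continuous
  rw [NNReal.coe_one, one_mul, dist_eq_norm, ← integral_sub (hi X) (hi Y)]
  have hXY : MemLp (fun ω => X ω - Y ω) 2 P := (Lp.memLp X).sub (Lp.memLp Y)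
  have hXY1 : Integrable (fun ω => X ω - Y ω) P := hXY.integrable (by norm_num)
  calc ‖∫ ω, (Complex.exp (Complex.I * (X ω : ℂ)) - Complex.exp (Complex.I * (Y ω : ℂ))) ∂P‖
      ≤ ∫ ω, ‖X ω - Y ω‖ ∂P := by
        refine norm_integral_le_of_norm_le hXY1.norm (ae_of_all _ fun ω => ?_)
        have h1 : Complex.exp (Complex.I * (X ω : ℂ)) - Complex.exp (Complex.I * (Y ω : ℂ)) =
            Complex.exp ((Y ω : ℂ) * Complex.I) *
              (Complex.exp (Complex.I * ((X ω - Y ω : ℝ) : ℂ)) - 1) := by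
          rw [mul_sub, ← Complex.exp_add, mul_one]
          push_cast
          ring_nf
        rw [h1, norm_mul, Complex.norm_exp_ofReal_mul_I, one_mul]
        exact Real.norm_exp_I_mul_ofReal_sub_one_le
    _ = (eLpNorm (fun ω => X ω - Y ω) 1 P).toReal := by
        rw [integral_norm_eq_lintegral_enorm hXY1.aestronglyMeasurable, eLpNorm_one_eq_lintegral_enorm]
    _ ≤ (eLpNorm (fun ω => X ω - Y ω) 2 P).toReal :=
        ENNReal.toReal_mono hXY.eLpNorm_ne_top
          (eLpNorm_le_eLpNorm_of_exponent_le (by norm_num) hXY.aestronglyMeasurable)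
    _ = dist X Y := by rw [Lp.dist_def]; rfl

end Gaussian

namespace IsWhiteNoiseMeasure

variable {σ : Measure ℝ} {P : Measure TemperedDual}

theorem map_pairing (hP : IsWhiteNoiseMeasure σ P) (s : 𝓢(ℝ, ℝ)) :
    P.map (pairing s) = gaussianReal 0 (∫ u, ‖fourierHat s u‖ ^ 2 ∂σ).toNNReal := by
  have := hP.isProbabilityMeasure
  refine map_eq_gaussianReal_of_integral_exp (measurable_pairing s).aemeasurable _ fun t => ?_
  -- Linearity absorbs `t` into the test function: the characteristic function at `t` is the
  -- functional at `t • s`.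
  simp_rw [← pairing_smul]
  rw [hP.charFunctional, Real.coe_toNNReal _ (integral_nonneg fun _ => by positivity),
    ← integral_const_mul]
  simp_rw [fourierHat_smul, norm_mul, mul_pow, Complex.norm_real, Real.norm_eq_abs, sq_abs]
  rw [neg_div]

theorem memLp_pairing (hP : IsWhiteNoiseMeasure σ P) (s : 𝓢(ℝ, ℝ)) : MemLp (pairing s) 2 P :=
  memLp_two_of_map_eq_gaussianReal (measurable_pairing s).aemeasurable (hP.map_pairing s)

theorem integral_pairing_sq (hP : IsWhiteNoiseMeasure σ P) (s : 𝓢(ℝ, ℝ)) :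
    ∫ ω, pairing s ω ^ 2 ∂P = ∫ u, ‖fourierHat s u‖ ^ 2 ∂σ := by
  have := hP.isProbabilityMeasure
  rw [integral_sq_of_map_eq_gaussianReal (measurable_pairing s).aemeasurable (hP.map_pairing s),
    Real.coe_toNNReal _ (integral_nonneg fun _ => by positivity)]

/-- Polarization: compare the second moment of `s + s'` with those of `s` and `s'`. Square
integrability of the transforms justifies expanding the spectral integral. -/
theorem integral_pairing_mul_pairing (hP : IsWhiteNoiseMeasure σ P) {s s' : 𝓢(ℝ, ℝ)}
    (hs : MemLp (fourierHat s) 2 σ) (hs' : MemLp (fourierHat s') 2 σ) :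
    ∫ ω, pairing s ω * pairing s' ω ∂P = ∫ u, inner ℝ (fourierHat s u) (fourierHat s' u) ∂σ := by
  have h := hP.integral_pairing_sq (s + s')
  have h1 := hP.memLp_pairing s
  have h2 := hP.memLp_pairing s'
  have hi : Integrable (fun u => inner ℝ (fourierHat s u) (fourierHat s' u)) σ := by
    have := L2.integrable_inner (𝕜 := ℝ) (hs.toLp _) (hs'.toLp _)
    refine this.congr ?_
    filter_upwards [hs.coeFn_toLp, hs'.coeFn_toLp] with x h1 h2
    rw [h1, h2]
  have hI1 : ∫ ω, pairing (s + s') ω ^ 2 ∂P = ∫ ω, pairing s ω ^ 2 ∂P +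
      2 * ∫ ω, pairing s ω * pairing s' ω ∂P + ∫ ω, pairing s' ω ^ 2 ∂P := by
    have h12 : Integrable (fun ω => pairing s ω * pairing s' ω) P := h1.integrable_mul h2
    rw [← integral_const_mul, ← integral_add h1.integrable_sq (h12.const_mul 2),
      ← integral_add (f := fun ω => pairing s ω ^ 2 + 2 * (pairing s ω * pairing s' ω))
        (h1.integrable_sq.add (h12.const_mul 2)) h2.integrable_sq]
    refine integral_congr_ae (ae_of_all _ fun ω => ?_)
    simp only [pairing_add]
    ring
  have hI2 : ∫ u, ‖fourierHat (s + s') u‖ ^ 2 ∂σ = ∫ u, ‖fourierHat s u‖ ^ 2 ∂σ +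
      2 * ∫ u, inner ℝ (fourierHat s u) (fourierHat s' u) ∂σ + ∫ u, ‖fourierHat s' u‖ ^ 2 ∂σ := by
    have hs1 := (memLp_two_iff_integrable_sq_norm hs.1).1 hs
    have hs2 := (memLp_two_iff_integrable_sq_norm hs'.1).1 hs'
    rw [← integral_const_mul, ← integral_add hs1 (hi.const_mul 2),
      ← integral_add (f := fun u => ‖fourierHat s u‖ ^ 2 +
        2 * inner ℝ (fourierHat s u) (fourierHat s' u)) (hs1.add (hi.const_mul 2)) hs2]
    refine integral_congr_ae (ae_of_all _ fun u => ?_)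
    simp only [fourierHat_add]
    exact norm_add_sq_real _ _
  rw [hI1, hI2, hP.integral_pairing_sq, hP.integral_pairing_sq] at h
  linarith

/-- The map `s ↦ ⟨s, ·⟩` into `L²(P)`. -/
def pairingLp (hP : IsWhiteNoiseMeasure σ P) : 𝓢(ℝ, ℝ) →ₗ[ℝ] Lp ℝ 2 P where
  toFun s := (hP.memLp_pairing s).toLp (pairing s)
  map_add' s s' := by
    rw [← MemLp.toLp_add]
    exact MemLp.toLp_congr _ _ (ae_of_all _ fun ω => pairing_add s s' ω)
  map_smul' c s := by
    rw [RingHom.id_apply, ← MemLp.toLp_const_smul]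
    exact MemLp.toLp_congr _ _ (ae_of_all _ fun ω => pairing_smul c s ω)

/-- The closure in `L²(P)` of the random variables `⟨s, ·⟩`. -/
def gaussianSpace (hP : IsWhiteNoiseMeasure σ P) : Submodule ℝ (Lp ℝ 2 P) :=
  hP.pairingLp.range.topologicalClosure

/-- Both sides are continuous on `L²(P)`, so the identity defines a closed set, and it holds for the
pairings. -/
theorem integral_exp_of_mem_gaussianSpace (hP : IsWhiteNoiseMeasure σ P) {X : Lp ℝ 2 P}
    (hX : X ∈ hP.gaussianSpace) :
    ∫ ω, Complex.exp (Complex.I * (X ω : ℂ)) ∂P = Complex.exp (-((‖X‖ ^ 2 : ℝ) : ℂ) / 2) := by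
  have := hP.isProbabilityMeasure
  have hcl : IsClosed {X : Lp ℝ 2 P | ∫ ω, Complex.exp (Complex.I * (X ω : ℂ)) ∂P =
      Complex.exp (-((‖X‖ ^ 2 : ℝ) : ℂ) / 2)} :=
    isClosed_eq continuous_integral_exp (by fun_prop)
  refine closure_minimal ?_ hcl hX
  rintro _ ⟨s, rfl⟩
  change ∫ ω, Complex.exp (Complex.I * (((hP.memLp_pairing s).toLp (pairing s)) ω : ℂ)) ∂P =
    Complex.exp (-((‖(hP.memLp_pairing s).toLp (pairing s)‖ ^ 2 : ℝ) : ℂ) / 2)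
  rw [← real_inner_self_eq_norm_sq, inner_toLp]
  simp_rw [← sq]
  rw [hP.integral_pairing_sq, neg_div, ← hP.charFunctional]
  refine integral_congr_ae ?_
  filter_upwards [(hP.memLp_pairing s).coeFn_toLp] with ω h
  rw [h]

theorem map_eq_gaussianReal (hP : IsWhiteNoiseMeasure σ P) {X : TemperedDual → ℝ}
    (hX : MemLp X 2 P) (hXG : hX.toLp X ∈ hP.gaussianSpace) :
    P.map X = gaussianReal 0 (‖hX.toLp X‖₊ ^ 2) := by
  have := hP.isProbabilityMeasure
  refine map_eq_gaussianReal_of_integral_exp hX.aestronglyMeasurable.aemeasurable _ fun t => ?_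
  have h := hP.integral_exp_of_mem_gaussianSpace (hP.gaussianSpace.smul_mem t hXG)
  rw [norm_smul, mul_pow, Real.norm_eq_abs, sq_abs] at h
  refine Eq.trans (integral_congr_ae ?_) h
  filter_upwards [Lp.coeFn_smul t (hX.toLp X), hX.coeFn_toLp] with ω h1 h2
  rw [h1, Pi.smul_apply, h2, smul_eq_mul]

theorem integral_eq_zero (hP : IsWhiteNoiseMeasure σ P) {X : TemperedDual → ℝ}
    (hX : MemLp X 2 P) (hXG : hX.toLp X ∈ hP.gaussianSpace) : ∫ ω, X ω ∂P = 0 :=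
  integral_eq_zero_of_map_eq_gaussianReal hX.aestronglyMeasurable.aemeasurable
    (hP.map_eq_gaussianReal hX hXG)

theorem exists_toLp_sum_mem_gaussianSpace (hP : IsWhiteNoiseMeasure σ P) {ι : Type*}
    {X : ι → TemperedDual → ℝ} (hX : ∀ i, MemLp (X i) 2 P)
    (hXG : ∀ i, (hX i).toLp (X i) ∈ hP.gaussianSpace) (c : ι → ℝ) (s : Finset ι) :
    ∃ h : MemLp (fun ω => ∑ i ∈ s, c i * X i ω) 2 P, h.toLp _ ∈ hP.gaussianSpace := by
  refine ⟨memLp_finsetSum s fun i _ => (hX i).const_mul (c i), ?_⟩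
  rw [toLp_finsetSum fun i => (hX i).const_mul (c i)]
  exact Submodule.sum_mem _ fun i _ => hP.gaussianSpace.smul_mem (c i) (hXG i)

/-- A linear functional of finitely many `X i` is a linear combination of them, hence again in
`gaussianSpace`. Joint Gaussianity thus reduces to the one-dimensional case. -/
theorem isGaussianProcess (hP : IsWhiteNoiseMeasure σ P) {ι : Type*}
    {X : ι → TemperedDual → ℝ} (hX : ∀ i, MemLp (X i) 2 P)
    (hXG : ∀ i, (hX i).toLp (X i) ∈ hP.gaussianSpace) : IsGaussianProcess X P := by
  classical
  refine ⟨fun I => ⟨isGaussian_of_map_eq_gaussianReal fun L => ?_⟩⟩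
  have hm : AEMeasurable (fun ω => I.restrict (X · ω)) P :=
    aemeasurable_pi_lambda _ fun i => (hX i).aestronglyMeasurable.aemeasurable
  rw [AEMeasurable.map_map_of_aemeasurable (by fun_prop) hm]
  obtain ⟨h, hG⟩ := hP.exists_toLp_sum_mem_gaussianSpace (fun i : I => hX i) (fun i => hXG i)
    (fun i => L fun j => if i = j then 1 else 0) Finset.univ
  refine ⟨0, ‖h.toLp _‖₊ ^ 2, ?_⟩
  rw [← hP.map_eq_gaussianReal h hG]
  congr 1
  ext ω
  refine (L.toLinearMap.pi_apply_eq_sum_univ (I.restrict (X · ω))).trans ?_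
  exact Finset.sum_congr rfl fun i _ => mul_comm _ _

end IsWhiteNoiseMeasure

/-! ## White noise sequences -/

section WhiteNoise

variable {σ : Measure ℝ} {P : Measure TemperedDual}

theorem IsWienerExtension.exists_seq {g : ℝ → ℂ} {Z : TemperedDual → ℝ}
    (hP : IsWhiteNoiseMeasure σ P) (h : IsWienerExtension σ P g Z) :
    ∃ (s : ℕ → 𝓢(ℝ, ℝ)) (hs : ∀ k, MemLp (fourierHat (s k)) 2 σ),
      Tendsto (fun k => (hs k).toLp (fourierHat (s k))) atTop (𝓝 (h.1.toLp g)) ∧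
      Tendsto (fun k => hP.pairingLp (s k)) atTop (𝓝 (h.2.1.toLp Z)) := by
  obtain ⟨hg, hZ, s, hs1, hs2⟩ := h
  -- Convergence gives finite `L²` distance to `g` only from some rank `K` on, so the approximating
  -- sequence is shifted by `K`.
  obtain ⟨K, hK⟩ := eventually_atTop.1 (hs1.eventually_lt_const (u := ∞) ENNReal.zero_lt_top)
  have hmem : ∀ k, MemLp (fourierHat (s (k + K))) 2 σ := by
    intro k
    have h1 : MemLp (fun u => fourierHat (s (k + K)) u - g u) 2 σ :=
      ⟨(stronglyMeasurable_fourierHat _).aestronglyMeasurable.sub hg.1, hK _ (Nat.le_add_left _ _)⟩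
    exact (h1.add hg).ae_eq (ae_of_all _ fun u => sub_add_cancel _ _)
  refine ⟨fun k => s (k + K), hmem, ?_, ?_⟩
  · exact (Lp.tendsto_Lp_iff_tendsto_eLpNorm'' _ hmem g hg).2
      (hs1.comp (tendsto_add_atTop_nat K))
  · exact (Lp.tendsto_Lp_iff_tendsto_eLpNorm'' _ (fun k => hP.memLp_pairing (s (k + K))) Z hZ).2
      (hs2.comp (tendsto_add_atTop_nat K))

theorem IsWienerExtension.mem_gaussianSpace {g : ℝ → ℂ} {Z : TemperedDual → ℝ}
    (hP : IsWhiteNoiseMeasure σ P) (h : IsWienerExtension σ P g Z) :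
    h.2.1.toLp Z ∈ hP.gaussianSpace := by
  obtain ⟨s, -, -, hs⟩ := h.exists_seq hP
  exact mem_closure_of_tendsto hs (Eventually.of_forall fun k => ⟨s k, rfl⟩)

/-- The Wiener extension is isometric. -/
theorem IsWienerExtension.integral_mul {g g' : ℝ → ℂ} {Z Z' : TemperedDual → ℝ}
    (hP : IsWhiteNoiseMeasure σ P) (h : IsWienerExtension σ P g Z)
    (h' : IsWienerExtension σ P g' Z') :
    ∫ ω, Z ω * Z' ω ∂P = ∫ u, (starRingEnd ℂ (g u) * g' u).re ∂σ := by
  obtain ⟨s, hs, hs1, hs2⟩ := h.exists_seq hP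
  obtain ⟨s', hs', hs1', hs2'⟩ := h'.exists_seq hP
  have h1 := hs1.inner (𝕜 := ℝ) hs1'
  have h2 := hs2.inner (𝕜 := ℝ) hs2'
  have h12 : ∀ k, inner ℝ (hP.pairingLp (s k)) (hP.pairingLp (s' k)) =
      inner ℝ ((hs k).toLp (fourierHat (s k))) ((hs' k).toLp (fourierHat (s' k))) := by
    intro k
    rw [inner_toLp_eq_integral_inner, ← hP.integral_pairing_mul_pairing (hs k) (hs' k)]
    exact inner_toLp (hP.memLp_pairing (s k)) (hP.memLp_pairing (s' k))
  simp_rw [h12] at h2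
  have := tendsto_nhds_unique h2 h1
  rw [inner_toLp, inner_toLp_eq_integral_inner] at this
  simpa only [Complex.inner, mul_comm] using this

theorem IsWhiteNoiseSequence.memLp {g : ℕ → ℝ → ℂ} {Z : ℕ → TemperedDual → ℝ}
    (hZ : IsWhiteNoiseSequence σ P g Z) (n : ℕ) : MemLp (Z n) 2 P :=
  (hZ.extension n).2.1

theorem IsWhiteNoiseSequence.orthonormal_toLp {g : ℕ → ℝ → ℂ} {Z : ℕ → TemperedDual → ℝ}
    (hP : IsWhiteNoiseMeasure σ P) (hZ : IsWhiteNoiseSequence σ P g Z) :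
    Orthonormal ℝ fun n => (hZ.memLp n).toLp (Z n) := by
  rw [orthonormal_iff_ite]
  intro i j
  rw [inner_toLp, (hZ.extension i).integral_mul hP (hZ.extension j), hZ.orthonormal]

end WhiteNoise

/-! ## Series in `L²` -/

section Series

variable {Ω : Type*} [MeasurableSpace Ω] {P : Measure Ω}

theorem IsL2Sum.tendsto_toLp {f : ℕ → Ω → ℝ} {X : Ω → ℝ} (h : IsL2Sum P f X) :
    Tendsto (fun N => ∑ n ∈ Finset.range N, (h.memLp_term n).toLp (f n)) atTop
      (𝓝 (h.memLp_sum.toLp X)) := by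
  simp_rw [← toLp_finsetSum h.memLp_term]
  exact (Lp.tendsto_Lp_iff_tendsto_eLpNorm'' _ _ X h.memLp_sum).2 h.tendsto

theorem exists_isL2Sum {Z : ℕ → Ω → ℝ} (hZ : ∀ n, MemLp (Z n) 2 P)
    (ho : Orthonormal ℝ fun n => (hZ n).toLp (Z n)) {a : ℕ → ℝ} (ha : Summable fun n => a n * a n) :
    ∃ X, IsL2Sum P (fun n ω => a n * Z n ω) X := by
  have hs : Summable fun n => a n • (hZ n).toLp (Z n) := by
    refine (ho.orthogonalFamily.summable_iff_norm_sq_summable a).2 (ha.congr fun n => ?_)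
    rw [Real.norm_eq_abs, sq_abs, sq]
  refine ⟨(∑' n, a n • (hZ n).toLp (Z n) : Lp ℝ 2 P), fun n => (hZ n).const_mul _, Lp.memLp _, ?_⟩
  have ht := hs.hasSum.tendsto_sum_nat
  have h : ∀ N, ∑ n ∈ Finset.range N, a n • (hZ n).toLp (Z n) =
      (memLp_finsetSum (Finset.range N) fun n _ => (hZ n).const_mul (a n)).toLp
        (fun ω => ∑ n ∈ Finset.range N, a n * Z n ω) := fun N =>
    (toLp_finsetSum (fun n => (hZ n).const_mul (a n)) (Finset.range N)).symm
  simp_rw [h] at ht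
  rw [← Lp.toLp_coeFn (∑' n, a n • (hZ n).toLp (Z n)) (Lp.memLp _)] at ht
  exact (Lp.tendsto_Lp_iff_tendsto_eLpNorm'' _ _ _ (Lp.memLp _)).1 ht

theorem IsL2Sum.integral_mul {Z : ℕ → Ω → ℝ} (hZ : ∀ n, MemLp (Z n) 2 P)
    (ho : Orthonormal ℝ fun n => (hZ n).toLp (Z n)) {a b : ℕ → ℝ} {X Y : Ω → ℝ}
    (hX : IsL2Sum P (fun n ω => a n * Z n ω) X) (hY : IsL2Sum P (fun n ω => b n * Z n ω) Y)
    {S : ℝ} (hS : HasSum (fun n => a n * b n) S) : ∫ ω, X ω * Y ω ∂P = S := by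
  rw [← inner_toLp hX.memLp_sum hY.memLp_sum]
  refine tendsto_nhds_unique (hX.tendsto_toLp.inner (𝕜 := ℝ) hY.tendsto_toLp) ?_
  refine hS.tendsto_sum_nat.congr fun N => ?_
  -- By orthonormality the inner product of the partial sums is the partial sum of `∑ a n * b n`.
  exact (ho.inner_sum a b (Finset.range N)).symm

theorem IsL2Sum.integral_mul_eq_zero {f f' : ℕ → Ω → ℝ} {X Y : Ω → ℝ}
    (hX : IsL2Sum P f X) (hY : IsL2Sum P f' Y) (h : ∀ m n, ∫ ω, f m ω * f' n ω ∂P = 0) :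
    ∫ ω, X ω * Y ω ∂P = 0 := by
  rw [← inner_toLp hX.memLp_sum hY.memLp_sum]
  refine tendsto_nhds_unique (hX.tendsto_toLp.inner (𝕜 := ℝ) hY.tendsto_toLp) ?_
  refine tendsto_const_nhds.congr fun N => ?_
  rw [sum_inner]
  simp_rw [inner_sum, inner_toLp, h]
  simp

theorem IsL2Sum.toLp_mem {f : ℕ → Ω → ℝ} {X : Ω → ℝ} (h : IsL2Sum P f X)
    {S : Submodule ℝ (Lp ℝ 2 P)} (hS : IsClosed (S : Set (Lp ℝ 2 P)))
    (hf : ∀ n, (h.memLp_term n).toLp (f n) ∈ S) : h.memLp_sum.toLp X ∈ S :=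
  hS.mem_of_tendsto h.tendsto_toLp
    (Eventually.of_forall fun _ => Submodule.sum_mem _ fun n _ => hf n)

end Series

/-! ## The hyperbolic fractional process -/

@[simp]
theorem lam₁_diagH (x y : ℝ) : lam₁ (diagH x y) = x := by
  simp [lam₁, diagH, ePlus, eMinus]; ring

@[simp]
theorem lam₂_diagH (x y : ℝ) : lam₂ (diagH x y) = y := by
  simp [lam₂, diagH, ePlus, eMinus]; ring

/-- Multiplicativity of the coordinates is what separates the hyperbolic covariance into two real
ones. -/
theorem lam₁_mul (p q : Hyperbolic) : lam₁ (p * q) = lam₁ p * lam₁ q := by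
  simp [lam₁]; ring

theorem lam₂_mul (p q : Hyperbolic) : lam₂ (p * q) = lam₂ p * lam₂ q := by
  simp [lam₂]; ring

theorem lam₁_sub (p q : Hyperbolic) : lam₁ (p - q) = lam₁ p - lam₁ q := by
  simp [lam₁]; ring

theorem lam₂_sub (p q : Hyperbolic) : lam₂ (p - q) = lam₂ p - lam₂ q := by
  simp [lam₂]; ring

theorem diagH_add (x y x' y' : ℝ) : diagH x y + diagH x' y' = diagH (x + x') (y + y') := by
  simp only [diagH, add_smul]; abel

theorem diagH_sub (x y x' y' : ℝ) : diagH x y - diagH x' y' = diagH (x - x') (y - y') := by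
  simp only [diagH, sub_smul]; abel

theorem smul_diagH (c x y : ℝ) : c • diagH x y = diagH (c * x) (c * y) := by
  simp only [diagH, smul_add, smul_smul]

theorem KH_eq (H : ℝ) (p q : Hyperbolic) :
    KH H p q = diagH
      (VConst H / Real.pi * (|lam₁ p| ^ (2 * H) + |lam₁ q| ^ (2 * H) -
        |lam₁ p - lam₁ q| ^ (2 * H)))
      (VConst H / Real.pi * (|lam₂ p| ^ (2 * H) + |lam₂ q| ^ (2 * H) -
        |lam₂ p - lam₂ q| ^ (2 * H))) := by
  simp only [KH, rpowH, absH, extendH, lam₁_diagH, lam₂_diagH, lam₁_sub, lam₂_sub, diagH_add,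
    diagH_sub, smul_diagH]

theorem cosIntegrand_eq (H : ℝ) (n : ℕ) (t : ℝ) :
    cosIntegrand H n t = fun u => cosKernel H t u * hermiteFun n u := by
  ext u; simp only [cosIntegrand, cosKernel]; ring

theorem sinIntegrand_eq (H : ℝ) (n : ℕ) (t : ℝ) :
    sinIntegrand H n t = fun u => sinKernel H t u * hermiteFun n u := by
  ext u; simp only [sinIntegrand, sinKernel]; ring

theorem hasSum_cosCoeff {H : ℝ} (hH0 : 0 < H) (hH1 : H < 1) (t s : ℝ) :
    HasSum (fun n => (∫ u, cosIntegrand H n t u) * ∫ u, cosIntegrand H n s u)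
      (∫ u, cosKernel H t u * cosKernel H s u) := by
  simp_rw [cosIntegrand_eq]
  exact hasSum_integral_mul_hermiteFun (memLp_two_cosKernel hH0 hH1 t)
    (memLp_two_cosKernel hH0 hH1 s)

theorem hasSum_sinCoeff {H : ℝ} (hH0 : 0 < H) (hH1 : H < 1) (t s : ℝ) :
    HasSum (fun n => (∫ u, sinIntegrand H n t u) * ∫ u, sinIntegrand H n s u)
      (∫ u, sinKernel H t u * sinKernel H s u) := by
  simp_rw [sinIntegrand_eq]
  exact hasSum_integral_mul_hermiteFun (memLp_two_sinKernel hH0 hH1 t)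
    (memLp_two_sinKernel hH0 hH1 s)

/-! ### The real process in one idempotent component -/

section Component

variable {H : ℝ} {σ : Measure ℝ} {P : Measure TemperedDual} {g : ℕ → ℝ → ℂ}
  {Z : ℕ → TemperedDual → ℝ} {B C : ℝ → TemperedDual → ℝ}

theorem exists_component_sums (hH0 : 0 < H) (hH1 : H < 1) (hP : IsWhiteNoiseMeasure σ P)
    (hZ : IsWhiteNoiseSequence σ P g Z) :
    (∃ B : ℝ → TemperedDual → ℝ,
      ∀ t, IsL2Sum P (fun n ω => (∫ u, cosIntegrand H n t u) * Z (2 * n) ω) (B t)) ∧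
    ∃ C : ℝ → TemperedDual → ℝ,
      ∀ t, IsL2Sum P (fun n ω => (∫ u, sinIntegrand H n t u) * Z (2 * n + 1) ω) (C t) := by
  have ho := hZ.orthonormal_toLp hP
  constructor
  · exact Classical.skolem.1 fun t => exists_isL2Sum (fun n => hZ.memLp (2 * n))
      (ho.comp (fun n => 2 * n) fun m n h => by simpa using h)
      -- Parseval on the diagonal is exactly the square summability of the coefficients.
      (hasSum_cosCoeff hH0 hH1 t t).summable
  · exact Classical.skolem.1 fun t => exists_isL2Sum (fun n => hZ.memLp (2 * n + 1))
      (ho.comp (fun n => 2 * n + 1) fun m n h => by simpa using h)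
      (hasSum_sinCoeff hH0 hH1 t t).summable

theorem memLp_component
    (hB : ∀ t, IsL2Sum P (fun n ω => (∫ u, cosIntegrand H n t u) * Z (2 * n) ω) (B t))
    (hC : ∀ t, IsL2Sum P (fun n ω => (∫ u, sinIntegrand H n t u) * Z (2 * n + 1) ω) (C t))
    (t : ℝ) : MemLp (fun ω => B t ω + C t ω) 2 P :=
  (hB t).memLp_sum.add (hC t).memLp_sum

/-- Membership in one common Gaussian space handles both series together, so no independence between
them has to be proved. -/
theorem component_mem_gaussianSpace (hP : IsWhiteNoiseMeasure σ P)
    (hZ : IsWhiteNoiseSequence σ P g Z)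
    (hB : ∀ t, IsL2Sum P (fun n ω => (∫ u, cosIntegrand H n t u) * Z (2 * n) ω) (B t))
    (hC : ∀ t, IsL2Sum P (fun n ω => (∫ u, sinIntegrand H n t u) * Z (2 * n + 1) ω) (C t))
    (t : ℝ) : (memLp_component hB hC t).toLp _ ∈ hP.gaussianSpace := by
  have hc : IsClosed (hP.gaussianSpace : Set (Lp ℝ 2 P)) :=
    Submodule.isClosed_topologicalClosure _
  have hm := fun n => (hZ.extension n).mem_gaussianSpace hP
  exact hP.gaussianSpace.add_mem
    ((hB t).toLp_mem hc fun n => hP.gaussianSpace.smul_mem _ (hm (2 * n)))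
    ((hC t).toLp_mem hc fun n => hP.gaussianSpace.smul_mem _ (hm (2 * n + 1)))

theorem integral_component_mul (hH0 : 0 < H) (hH1 : H < 1) (hP : IsWhiteNoiseMeasure σ P)
    (hZ : IsWhiteNoiseSequence σ P g Z)
    (hB : ∀ t, IsL2Sum P (fun n ω => (∫ u, cosIntegrand H n t u) * Z (2 * n) ω) (B t))
    (hC : ∀ t, IsL2Sum P (fun n ω => (∫ u, sinIntegrand H n t u) * Z (2 * n + 1) ω) (C t))
    (t s : ℝ) :
    ∫ ω, (B t ω + C t ω) * (B s ω + C s ω) ∂P =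
      VConst H / Real.pi * (|t| ^ (2 * H) + |s| ^ (2 * H) - |t - s| ^ (2 * H)) := by
  have ho := hZ.orthonormal_toLp hP
  have hBB := (hB t).integral_mul (fun n => hZ.memLp (2 * n))
    (ho.comp (fun n => 2 * n) fun m n h => by simpa using h) (hB s)
    (hasSum_cosCoeff hH0 hH1 t s)
  have hCC := (hC t).integral_mul (fun n => hZ.memLp (2 * n + 1))
    (ho.comp (fun n => 2 * n + 1) fun m n h => by simpa using h) (hC s)
    (hasSum_sinCoeff hH0 hH1 t s)
  -- An even index `2m` never equals an odd index `2n+1`, so the cosine and sine series are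
  -- orthogonal term by term.
  have hcross : ∀ t s, ∫ ω, B t ω * C s ω ∂P = 0 := fun t s =>
    (hB t).integral_mul_eq_zero (hC s) fun m n => by
      refine (integral_congr_ae (ae_of_all _ fun ω =>
        mul_mul_mul_comm _ (Z (2 * m) ω) _ (Z (2 * n + 1) ω))).trans ?_
      rw [integral_const_mul, (hZ.extension _).integral_mul hP (hZ.extension _), hZ.orthonormal,
        if_neg (by lia), mul_zero]
  have hi : ∀ {X Y : TemperedDual → ℝ}, MemLp X 2 P → MemLp Y 2 P →
      Integrable (fun ω => X ω * Y ω) P := fun hX hY => hX.integrable_mul hY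
  have hb := fun t => (hB t).memLp_sum
  have hc := fun t => (hC t).memLp_sum
  rw [← integral_cosKernel_mul_add_integral_sinKernel_mul hH0 hH1, ← hBB, ← hCC]
  have hexp : ∀ ω, (B t ω + C t ω) * (B s ω + C s ω) =
      (B t ω * B s ω + C t ω * C s ω) + (B t ω * C s ω + B s ω * C t ω) := fun ω => by ring
  simp_rw [hexp]
  rw [integral_add (f := fun ω => B t ω * B s ω + C t ω * C s ω)
      (g := fun ω => B t ω * C s ω + B s ω * C t ω) ((hi (hb t) (hb s)).add (hi (hc t) (hc s)))
      ((hi (hb t) (hc s)).add (hi (hb s) (hc t))),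
    integral_add (hi (hb t) (hb s)) (hi (hc t) (hc s)),
    integral_add (hi (hb t) (hc s)) (hi (hb s) (hc t)), hcross, hcross]
  ring

end Component

end HypFBM

end

theorem mainTheorem4 (H : ℝ) (hH0 : 0 < H) (hH1 : H < 1)
    (σ μ : MeasureTheory.Measure ℝ) (hσ : HypFBM.IsAdmissible σ) (hμ : HypFBM.IsAdmissible μ)
    (P₁ P₂ : MeasureTheory.Measure HypFBM.TemperedDual)
    (hP₁ : HypFBM.IsWhiteNoiseMeasure σ P₁) (hP₂ : HypFBM.IsWhiteNoiseMeasure μ P₂)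
    (g h : ℕ → ℝ → ℂ) (Z W : ℕ → HypFBM.TemperedDual → ℝ)
    (hZ : HypFBM.IsWhiteNoiseSequence σ P₁ g Z) (hW : HypFBM.IsWhiteNoiseSequence μ P₂ h W) :
    -- the coefficients of the four series are well defined
    (∀ (n : ℕ) (t : ℝ), MeasureTheory.Integrable (HypFBM.cosIntegrand H n t) ∧
      MeasureTheory.Integrable (HypFBM.sinIntegrand H n t)) ∧
    -- the four series converge in mean square
    (∃ B1 B2 B3 B4 : ℝ → HypFBM.TemperedDual → ℝ,
      HypFBM.AreComponents H P₁ P₂ Z W B1 B2 B3 B4) ∧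
    -- whatever versions of the sums are chosen, the process is centered Gaussian
    -- with the stated covariance function
    (∀ B1 B2 B3 B4 : ℝ → HypFBM.TemperedDual → ℝ,
      HypFBM.AreComponents H P₁ P₂ Z W B1 B2 B3 B4 →
      HypFBM.IsSecondOrderH P₁ P₂ (HypFBM.hypProcess B1 B2 B3 B4) ∧
      HypFBM.IsCenteredH P₁ P₂ (HypFBM.hypProcess B1 B2 B3 B4) ∧
      HypFBM.IsGaussianH P₁ P₂ (HypFBM.hypProcess B1 B2 B3 B4) ∧
      ∀ p q : HypFBM.Hyperbolic,
        HypFBM.covarianceH P₁ P₂ (HypFBM.hypProcess B1 B2 B3 B4) p q = HypFBM.KH H p q) ∧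
    -- the constant
    MeasureTheory.IntegrableOn (HypFBM.VIntegrand H) (Set.Ioi 0) ∧
    HypFBM.VConst H =
      (if H = 1 / 2 then Real.pi / 2
       else Real.Gamma (2 - 2 * H) * Real.cos (H * Real.pi) / ((1 - 2 * H) * (2 * H))) := by
  refine ⟨fun n t => ⟨?_, ?_⟩, ?_, ?_, HypFBM.integrableOn_VIntegrand hH0 hH1,
    HypFBM.VConst_eq hH0 hH1⟩
  · rw [HypFBM.cosIntegrand_eq]
    exact (HypFBM.memLp_two_cosKernel hH0 hH1 t).integrable_mul (HypFBM.memLp_two_hermiteFun n)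
  · rw [HypFBM.sinIntegrand_eq]
    exact (HypFBM.memLp_two_sinKernel hH0 hH1 t).integrable_mul (HypFBM.memLp_two_hermiteFun n)
  · obtain ⟨⟨B1, h1⟩, B3, h3⟩ := HypFBM.exists_component_sums hH0 hH1 hP₁ hZ
    obtain ⟨⟨B2, h2⟩, B4, h4⟩ := HypFBM.exists_component_sums hH0 hH1 hP₂ hW
    exact ⟨B1, B2, B3, B4, h1, h2, h3, h4⟩
  · rintro B1 B2 B3 B4 ⟨h1, h2, h3, h4⟩
    have hm₁ := HypFBM.memLp_component h1 h3
    have hm₂ := HypFBM.memLp_component h2 h4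
    have hG₁ := HypFBM.component_mem_gaussianSpace hP₁ hZ h1 h3
    have hG₂ := HypFBM.component_mem_gaussianSpace hP₂ hW h2 h4
    refine ⟨fun p => ?_, fun p => ?_, ⟨?_, ?_⟩, fun p q => ?_⟩
    · simp only [HypFBM.hypProcess, HypFBM.lam₁_diagH, HypFBM.lam₂_diagH]
      exact ⟨hm₁ _, hm₂ _⟩
    · simp only [HypFBM.expectationH, HypFBM.hypProcess, HypFBM.lam₁_diagH, HypFBM.lam₂_diagH]
      rw [hP₁.integral_eq_zero (hm₁ _) (hG₁ _), hP₂.integral_eq_zero (hm₂ _) (hG₂ _)]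
      simp [HypFBM.diagH]
    · simp only [HypFBM.hypProcess, HypFBM.lam₁_diagH]
      exact hP₁.isGaussianProcess (fun p => hm₁ (HypFBM.lam₁ p)) fun p => hG₁ _
    · simp only [HypFBM.hypProcess, HypFBM.lam₂_diagH]
      exact hP₂.isGaussianProcess (fun p => hm₂ (HypFBM.lam₂ p)) fun p => hG₂ _
    · simp only [HypFBM.covarianceH, HypFBM.expectationH, HypFBM.lam₁_mul, HypFBM.lam₂_mul,
        HypFBM.hypProcess, HypFBM.lam₁_diagH, HypFBM.lam₂_diagH]
      rw [HypFBM.integral_component_mul hH0 hH1 hP₁ hZ h1 h3,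
        HypFBM.integral_component_mul hH0 hH1 hP₂ hW h2 h4, HypFBM.KH_eq]
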